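/- Let $\beta(q)$ be the sixth order mock theta function, defined as a formal power series (with integer coefficients) by $$\beta(q)=\sum_{n=0}^{\infty}\frac{q^{3n^2+3n+1}}{(q;q^3)_{n+1}\,(q^2;q^3)_{n+1}}=:\sum_{n=0}^{\infty}p_\beta(n)\,q^n,$$ where $(a;q)_m=\prod_{k=0}^{m-1}(1-aq^k)$. Then for every integer $n\ge 0$, $$p_\beta(15n+7)\equiv 0 \pmod 5,\qquad p_\beta(45n+23)\equiv 0 \pmod{15},\qquad p_\beta(45n+41)\equiv 0 \pmod{15}.$$ -/

import Mathlib

open scoped PowerSeries PowerSeries.WithPiTopology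

/-- The finite `q`-shifted factorial `(a; q)_n = ∏_{k=0}^{n-1} (1 - a q^k)` in a commutative ring. -/
def qShiftedFactorial {R : Type*} [CommRing R] (a q : R) (n : ℕ) : R :=
  ∏ k ∈ Finset.range n, (1 - a * q ^ k)

/-- The denominator `(q; q^3)_{n+1} (q^2; q^3)_{n+1}` of the `n`-th summand of `β(q)`,
as a formal power series in `q = X`. -/
noncomputable def betaDenominator (n : ℕ) : ℤ⟦X⟧ :=
  qShiftedFactorial (PowerSeries.X : ℤ⟦X⟧) (PowerSeries.X ^ 3) (n + 1) *
    qShiftedFactorial ((PowerSeries.X : ℤ⟦X⟧) ^ 2) (PowerSeries.X ^ 3) (n + 1)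

/-- The `n`-th summand `q^(3n^2+3n+1) / ((q; q^3)_{n+1} (q^2; q^3)_{n+1})` of `β(q)`.
The denominator has constant coefficient `1`, so it is invertible over `ℤ`. -/
noncomputable def betaSummand (n : ℕ) : ℤ⟦X⟧ :=
  PowerSeries.X ^ (3 * n ^ 2 + 3 * n + 1) * PowerSeries.invOfUnit (betaDenominator n) 1

/-- The sixth order mock theta function `β(q)` as a formal power series: the sum of the summands
in the topology of coefficientwise convergence. -/
noncomputable def mockThetaBeta : ℤ⟦X⟧ :=
  ∑' n : ℕ, betaSummand n

/-- `p_β(n)`, the coefficient of `q^n` in `β(q)`. -/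
noncomputable def pBeta (n : ℕ) : ℤ :=
  PowerSeries.coeff n mockThetaBeta

/-- The constant coefficient of the denominator is `1`. -/
theorem constantCoeff_betaDenominator (n : ℕ) :
    PowerSeries.constantCoeff (betaDenominator n) = 1 := by
  simp [betaDenominator, qShiftedFactorial, map_prod]

/-- The inverse in `betaSummand` is a genuine inverse. -/
theorem betaSummand_mul_betaDenominator (n : ℕ) :
    betaSummand n * betaDenominator n = PowerSeries.X ^ (3 * n ^ 2 + 3 * n + 1) := by
  have h : betaDenominator n * PowerSeries.invOfUnit (betaDenominator n) 1 = 1 :=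
    PowerSeries.mul_invOfUnit _ _ (by simp [constantCoeff_betaDenominator])
  rw [betaSummand, mul_assoc, mul_comm _ (betaDenominator n), h, mul_one]

/-- The series defining `β(q)` converges, so the infinite sum is a genuine one. -/
theorem summable_betaSummand : Summable betaSummand := by
  rw [PowerSeries.WithPiTopology.summable_iff_summable_coeff]
  intro d
  refine summable_of_ne_finset_zero (s := Finset.range (d + 1)) fun n hn => ?_
  have hd : d < 3 * n ^ 2 + 3 * n + 1 := by
    have : d + 1 ≤ n := by simpa using hn
    nlinarith [sq_nonneg n]
  rw [betaSummand, PowerSeries.coeff_X_pow_mul', if_neg (by omega)]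

/-!
Bailey's lemma, applied to a partial fraction Bailey pair, turns `β(q)` into a quotient of a
level-three Appell–Lerch sum by an Euler product. Expanding `1 / (1 - a)` as
`(1 + a + a ^ 2) / (1 - a ^ 3)` and sorting the exponents modulo `3` gives, with
`E(q) = ∏ (1 - q ^ k)`,
`∑ p_β(3 n + 1) q ^ n = E(q ^ 3) ^ 3 / E(q) ^ 2`,
while `∑ p_β(3 n + 2) q ^ n` is an Appell–Lerch sum over `E(q)`. A recurrence in the powers of an
auxiliary variable makes `q E(q ^ 3) ^ 3` times it a Lambert series minus a series in `q ^ 3`. The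
part of the Lambert series with exponents `≡ 2` modulo `3` is a product of Kronecker's sums, whence
`∑ p_β(9 n + 5) q ^ n = 3 E(q ^ 3) ^ 6 / E(q) ^ 5`.
Modulo `5` one has `E(q) ^ 5 = E(q ^ 5)`, the exponents of `E` lie in the classes `0, 1, 2`
(pentagonal numbers), and by Jacobi's identity those of `E ^ 3` lie in the classes `0, 1`, since a
triangular number `≡ 3` carries a coefficient divisible by `5`.
-/

namespace MockTheta

open Filter Topology WithZero

section Order

variable {K : Type*} [Field K] [Valued K ℤᵐ⁰] {ι κ : Type*}

/-- `OrdGE D f` says that `f` vanishes to order at least `D`, the order of an element of a field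
with a `ℤᵐ⁰`-valued valuation being the negative of the exponent of its valuation. -/
def OrdGE (D : ℤ) (f : K) : Prop := Valued.v f ≤ exp (-D)

variable {D D' : ℤ} {f g t : K}

theorem OrdGE.mono (hf : OrdGE D f) (h : D' ≤ D) : OrdGE D' f :=
  le_trans hf (exp_le_exp.2 (neg_le_neg h))

theorem OrdGE.add (hf : OrdGE D f) (hg : OrdGE D g) : OrdGE D (f + g) :=
  Valuation.map_add_le _ hf hg

theorem OrdGE.sub (hf : OrdGE D f) (hg : OrdGE D g) : OrdGE D (f - g) :=
  Valuation.map_sub_le (v := Valued.v) hf hg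

theorem OrdGE.neg (hf : OrdGE D f) : OrdGE D (-f) := by
  rwa [OrdGE, Valuation.map_neg]

theorem OrdGE.mul (hf : OrdGE D f) (hg : OrdGE D' g) : OrdGE (D + D') (f * g) := by
  rw [OrdGE, map_mul, neg_add, exp_add]
  exact mul_le_mul' hf hg

theorem OrdGE.mul_left (hf : OrdGE 0 f) (hg : OrdGE D g) : OrdGE D (f * g) := by
  simpa only [zero_add] using hf.mul hg

theorem OrdGE.mul_right (hf : OrdGE D f) (hg : OrdGE 0 g) : OrdGE D (f * g) := by
  simpa only [add_zero] using hf.mul hg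

theorem ordGE_zero (D : ℤ) : OrdGE D (0 : K) := by simp [OrdGE]

theorem ordGE_zero_iff : OrdGE 0 f ↔ Valued.v f ≤ 1 := by simp [OrdGE]

theorem ordGE_one : OrdGE 0 (1 : K) := by simp [OrdGE]

theorem ordGE_neg_one_pow (n : ℕ) : OrdGE 0 ((-1 : K) ^ n) := by simp [OrdGE]

theorem ordGE_neg_one_zpow (n : ℤ) : OrdGE 0 ((-1 : K) ^ n) := by simp [OrdGE]

theorem ordGE_intCast (n : ℤ) : OrdGE 0 (n : K) :=
  ordGE_zero_iff.2 (intCast_mem (Valued.v (R := K)).integer n)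

theorem OrdGE.pow (hf : OrdGE D f) (n : ℕ) : OrdGE (n * D) (f ^ n) := by
  rw [OrdGE, map_pow, ← smul_eq_mul, natCast_zsmul, ← smul_neg, exp_nsmul]
  exact pow_le_pow_left₀ zero_le hf n

theorem OrdGE.natCast_pow (ht : OrdGE 1 t) (n : ℕ) : OrdGE n (t ^ n) := by
  simpa only [mul_one] using ht.pow n

theorem OrdGE.zpow (ht : OrdGE 1 t) {n : ℤ} (hn : 0 ≤ n) : OrdGE n (t ^ n) := by
  lift n to ℕ using hn
  simpa only [zpow_natCast] using ht.natCast_pow n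

theorem OrdGE.zpow_of_pos (ht : OrdGE 1 t) {n : ℤ} (hn : 0 < n) : OrdGE 1 (t ^ n) :=
  (ht.zpow hn.le).mono hn

theorem OrdGE.pow_of_pos (ht : OrdGE 1 t) {n : ℕ} (hn : 0 < n) : OrdGE 1 (t ^ n) := by
  simpa only [zpow_natCast] using ht.zpow_of_pos (Int.natCast_pos.2 hn)

theorem OrdGE.mul_zpow (hf : OrdGE 1 f) (ht : OrdGE 1 t) {n : ℤ} (hn : 0 ≤ n) :
    OrdGE 1 (f * t ^ n) :=
  hf.mul_right ((ht.zpow hn).mono hn)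

theorem OrdGE.mul_pow (hf : OrdGE 1 f) (ht : OrdGE 1 t) (n : ℕ) : OrdGE 1 (f * t ^ n) := by
  simpa only [zpow_natCast] using hf.mul_zpow ht n.cast_nonneg

theorem OrdGE.valuation_lt_one (hf : OrdGE 1 f) : Valued.v f < 1 :=
  lt_of_le_of_lt hf (by rw [← exp_zero, exp_lt_exp]; norm_num)

theorem OrdGE.valuation_one_sub (hf : OrdGE 1 f) : Valued.v (1 - f) = 1 :=
  Valuation.map_one_sub_of_lt _ hf.valuation_lt_one

theorem OrdGE.one_sub_ne_zero (hf : OrdGE 1 f) : 1 - f ≠ 0 := fun h => by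
  simpa [h] using hf.valuation_one_sub

theorem OrdGE.ne_one (hf : OrdGE 1 f) : f ≠ 1 := fun h =>
  hf.one_sub_ne_zero (sub_eq_zero.2 h.symm)

theorem OrdGE.zpow_ne_one (ht : OrdGE 1 t) {n : ℤ} (hn : n ≠ 0) : t ^ n ≠ 1 := by
  rcases lt_or_gt_of_ne hn with h | h
  · rw [← inv_inv (t ^ n), ← zpow_neg, ne_eq, inv_eq_one]
    exact (ht.zpow_of_pos (neg_pos.2 h)).ne_one
  · exact (ht.zpow_of_pos h).ne_one

theorem OrdGE.pow_succ_ne_one (ht : OrdGE 1 t) (k : ℕ) : t ^ (k + 1) ≠ 1 :=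
  (ht.pow_of_pos k.succ_pos).ne_one

theorem ordGE_inv_of_valuation_eq_one (hf : Valued.v f = 1) : OrdGE 0 f⁻¹ := by
  simp [OrdGE, hf]

theorem OrdGE.inv_one_sub (hf : OrdGE 1 f) : OrdGE 0 (1 - f)⁻¹ :=
  ordGE_inv_of_valuation_eq_one hf.valuation_one_sub

theorem ordGE_sum {f : ι → K} (s : Finset ι) (h : ∀ i ∈ s, OrdGE D (f i)) :
    OrdGE D (∑ i ∈ s, f i) :=
  Valuation.map_sum_le _ h

theorem eq_zero_of_ordGE (h : ∀ D : ℕ, OrdGE D f) : f = 0 := by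
  by_contra hf
  have hv : Valued.v f ≠ 0 := (Valuation.ne_zero_iff _).2 hf
  have hlog : exp (log (Valued.v f)) ≤ exp (-((1 - log (Valued.v f)).toNat : ℤ)) := by
    rw [exp_log hv]
    exact h _
  have := exp_le_exp.1 hlog
  omega

instance nonarchimedeanRing : NonarchimedeanRing K where
  is_nonarchimedean U hU := by
    obtain ⟨γ, hγ⟩ := (Valued.mem_nhds_zero (R := K)).1 hU
    exact ⟨⟨Valued.v.restrict.ltAddSubgroup γ, AddSubgroup.isOpen_of_mem_nhds (g := 0) _
      (Valued.mem_nhds_zero.2 ⟨γ, subset_rfl⟩)⟩, hγ⟩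

theorem eventually_nhds_zero_ordGE (D : ℤ) : ∀ᶠ f in 𝓝 (0 : K), OrdGE D f := by
  by_cases h : ∃ x : K, x ≠ 0 ∧ OrdGE D x
  · obtain ⟨x, hx0, hx⟩ := h
    have hne : Valued.v.restrict x ≠ 0 := (Valuation.ne_zero_iff _).2 hx0
    filter_upwards [(Valued.isOpen_closedBall K hne).mem_nhds (by simp)] with f hf
    exact ((Valuation.restrict_le_iff _).1 hf).trans hx
  · have : DiscreteTopology K := Valued.discreteTopology_of_forall_lt (r := exp (-D)) exp_ne_zero
      fun x hx => not_le.1 fun hle => h ⟨x, (Valuation.ne_zero_iff _).1 hx, hle⟩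
    rw [nhds_discrete]
    exact ordGE_zero D

theorem isClosed_setOf_ordGE (D : ℤ) : IsClosed {f : K | OrdGE D f} := by
  let H : AddSubgroup K :=
    { carrier := {f | OrdGE D f}
      add_mem' := OrdGE.add
      zero_mem' := ordGE_zero D
      neg_mem' := OrdGE.neg }
  exact H.isClosed_of_isOpen (H.isOpen_of_mem_nhds (g := 0) (eventually_nhds_zero_ordGE D))

theorem OrdGE.of_tendsto {l : Filter ι} [l.NeBot] {f : ι → K} {a : K} (ha : Tendsto f l (𝓝 a))
    (h : ∀ i, OrdGE D (f i)) : OrdGE D a :=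
  (isClosed_setOf_ordGE D).mem_of_tendsto ha (Eventually.of_forall h)

theorem ordGE_tsum {f : ι → K} (h : ∀ i, OrdGE D (f i)) : OrdGE D (∑' i, f i) := by
  by_cases hf : Summable f
  · exact .of_tendsto hf.hasSum fun s => ordGE_sum s fun i _ => h i
  · rw [tsum_eq_zero_of_not_summable hf]
    exact ordGE_zero D

theorem tendsto_zero_iff_ordGE {l : Filter ι} {f : ι → K} :
    Tendsto f l (𝓝 0) ↔ ∀ D : ℤ, ∀ᶠ i in l, OrdGE D (f i) := by
  refine ⟨fun h D => h.eventually (eventually_nhds_zero_ordGE D), fun h => ?_⟩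
  refine tendsto_def.2 fun s hs => ?_
  obtain ⟨γ, hγ⟩ := Valued.mem_nhds_zero.1 hs
  have hne : MonoidWithZeroHom.ValueGroup₀.embedding γ.1 ≠ 0 := by simp
  filter_upwards [h (1 - log (MonoidWithZeroHom.ValueGroup₀.embedding γ.1))] with i hi
  refine hγ ?_
  rw [Set.mem_ofPred_eq, Valuation.restrict_lt_iff_lt_embedding, ← exp_log hne]
  exact lt_of_le_of_lt hi (exp_lt_exp.2 (by omega))

theorem tendsto_zero_of_ordGE {l : Filter ι} {f : ι → K} {e : ι → ℤ} (he : Tendsto e l atTop)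
    (h : ∀ i, OrdGE (e i) (f i)) : Tendsto f l (𝓝 0) :=
  tendsto_zero_iff_ordGE.2 fun D => (he.eventually_ge_atTop D).mono fun i hi => (h i).mono hi

theorem tendsto_iff_ordGE_sub {l : Filter ι} {f : ι → K} {a : K} :
    Tendsto f l (𝓝 a) ↔ ∀ D : ℤ, ∀ᶠ i in l, OrdGE D (f i - a) := by
  rw [← tendsto_sub_nhds_zero_iff, tendsto_zero_iff_ordGE]

theorem tendsto_natCast_cofinite : Tendsto (fun n : ℕ => (n : ℤ)) cofinite atTop :=
  Nat.cofinite_eq_atTop ▸ tendsto_natCast_atTop_atTop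

theorem tendsto_abs_cofinite : Tendsto (fun n : ℤ => |n|) cofinite atTop := by
  rw [Int.cofinite_eq]
  exact tendsto_abs_atBot_atTop.sup tendsto_abs_atTop_atTop

theorem tendsto_add_cofinite_of_nonneg {e : ι → ℤ} {e' : κ → ℤ} (he : Tendsto e cofinite atTop)
    (he' : Tendsto e' cofinite atTop) (h0 : ∀ i, 0 ≤ e i) (h0' : ∀ j, 0 ≤ e' j) :
    Tendsto (fun p : ι × κ => e p.1 + e' p.2) cofinite atTop := by
  refine tendsto_atTop.2 fun D => ?_
  have hfin := (eventually_cofinite.1 (he.eventually_ge_atTop D)).prod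
    (eventually_cofinite.1 (he'.eventually_ge_atTop D))
  refine eventually_cofinite.2 (hfin.subset fun p hp => ?_)
  have h1 := h0 p.1
  have h2 := h0' p.2
  simp only [Set.mem_ofPred_eq, Set.mem_prod] at *
  omega

theorem summable_of_ordGE [CompleteSpace K] {f : ι → K} {e : ι → ℤ}
    (he : Tendsto e cofinite atTop) (h : ∀ i, OrdGE (e i) (f i)) : Summable f :=
  NonarchimedeanAddGroup.summable_of_tendsto_cofinite_zero (tendsto_zero_of_ordGE he h)

/-- **Tannery's theorem** over a nonarchimedean field. -/
theorem tendsto_tsum_of_ordGE [CompleteSpace K] {F : ℕ → ι → K} {G : ι → K} {e : ι → ℤ}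
    (he : Tendsto e cofinite atTop) (h : ∀ n i, OrdGE (e i) (F n i))
    (hF : ∀ i, Tendsto (F · i) atTop (𝓝 (G i))) :
    Tendsto (fun n => ∑' i, F n i) atTop (𝓝 (∑' i, G i)) := by
  have hG (i) : OrdGE (e i) (G i) := .of_tendsto (hF i) fun n => h n i
  refine tendsto_iff_ordGE_sub.2 fun D => ?_
  have hfin := eventually_cofinite.1 (he.eventually_ge_atTop D)
  have hev : ∀ᶠ n in atTop, ∀ i ∈ hfin.toFinset, OrdGE D (F n i - G i) :=
    (eventually_all_finset _).2 fun i _ => tendsto_iff_ordGE_sub.1 (hF i) D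
  filter_upwards [hev] with n hn
  rw [← (summable_of_ordGE he (h n)).tsum_sub (summable_of_ordGE he hG)]
  refine ordGE_tsum fun i => ?_
  by_cases hi : D ≤ e i
  · exact ((h n i).sub (hG i)).mono hi
  · exact hn i (by simpa using hi)

end Order

section Triangular

/-- The triangular number `x (x + 1) / 2` of an integer `x`; the division is exact. -/
def tri (x : ℤ) : ℤ := x * (x + 1) / 2

theorem two_mul_tri (x : ℤ) : 2 * tri x = x * (x + 1) :=
  Int.two_mul_ediv_two_of_even (Int.even_mul_succ_self x)

theorem tri_zero : tri 0 = 0 := rfl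

theorem tri_add_one (x : ℤ) : tri (x + 1) = tri x + (x + 1) := by
  linarith [two_mul_tri x, two_mul_tri (x + 1)]

theorem tri_sub_one (x : ℤ) : tri (x - 1) = tri x - x := by
  linarith [two_mul_tri x, two_mul_tri (x - 1)]

theorem tri_neg_one_sub (x : ℤ) : tri (-1 - x) = tri x := by
  linarith [two_mul_tri x, two_mul_tri (-1 - x)]

theorem abs_le_tri_add_one (x : ℤ) : |x| ≤ tri x + 1 := by
  have h := two_mul_tri x
  rcases le_or_gt 0 x with hx | hx
  · rw [abs_of_nonneg hx]
    nlinarith [mul_self_nonneg (x - 1)]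
  · rw [abs_of_neg hx]
    nlinarith [mul_nonneg (neg_nonneg.2 hx.le) (sub_nonneg.2 (Int.le_sub_one_of_lt hx))]

theorem tri_nonneg (x : ℤ) : 0 ≤ tri x := by
  rcases eq_or_ne x 0 with rfl | hx
  · exact tri_zero.ge
  · linarith [abs_le_tri_add_one x, Int.one_le_abs hx]

theorem self_le_tri {x : ℤ} : x ≤ tri x := by
  have h := tri_sub_one x
  linarith [tri_nonneg (x - 1)]

end Triangular

section BaileyPair

variable {F : Type*} [Field F] {t x y : F}

/-- The finite product `(t; t)_n`. -/
def poch (t : F) (n : ℕ) : F := ∏ k ∈ Finset.range n, (1 - t ^ (k + 1))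

/-- The reciprocal of `(t; t)_m` for an integer `m`, which vanishes by convention for `m < 0`. -/
def pochInv (t : F) (m : ℤ) : F := if 0 ≤ m then (poch t m.toNat)⁻¹ else 0

theorem poch_succ (t : F) (n : ℕ) : poch t (n + 1) = poch t n * (1 - t ^ (n + 1)) :=
  Finset.prod_range_succ _ _

theorem poch_ne_zero (h1 : ∀ k : ℕ, t ^ (k + 1) ≠ 1) (n : ℕ) : poch t n ≠ 0 :=
  Finset.prod_ne_zero_iff.2 fun k _ => sub_ne_zero.2 (h1 k).symm

theorem pochInv_natCast (t : F) (n : ℕ) : pochInv t n = (poch t n)⁻¹ := by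
  simp [pochInv]

theorem pochInv_of_neg (t : F) {m : ℤ} (hm : m < 0) : pochInv t m = 0 :=
  if_neg (not_le.2 hm)

theorem pochInv_zero (t : F) : pochInv t 0 = 1 := by
  simp [pochInv, poch]

theorem pochInv_one (t : F) : pochInv t 1 = (1 - t)⁻¹ := by
  simp [pochInv, poch]

theorem pochInv_sub_one (h1 : ∀ k : ℕ, t ^ (k + 1) ≠ 1) (m : ℤ) :
    pochInv t (m - 1) = (1 - t ^ m) * pochInv t m := by
  rcases lt_trichotomy m 0 with h | rfl | h
  · rw [pochInv_of_neg t h, pochInv_of_neg t (by omega), mul_zero]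
  · rw [pochInv_of_neg t (by omega), zpow_zero, sub_self, zero_mul]
  · obtain ⟨k, rfl⟩ : ∃ k : ℕ, m = k + 1 := ⟨(m - 1).toNat, by omega⟩
    rw [add_sub_cancel_right, ← Nat.cast_succ, pochInv_natCast, pochInv_natCast, zpow_natCast,
      poch_succ, mul_inv, mul_left_comm, mul_inv_cancel₀ (sub_ne_zero.2 (h1 k).symm), mul_one]

/-- The sequence `β n = ∑ r ≤ n, α r / ((t; t)_{n-r} (t; t)_{n+r+1})`. Up to the constant factor
`1 - t`, the pair `(α, β)` is a Bailey pair relative to `t`. -/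
def baileyTransform (t : F) (α : ℕ → F) (n : ℕ) : F :=
  ∑ r ∈ Finset.range (n + 1), α r * (pochInv t (n - r) * pochInv t (n + r + 1))

theorem baileyTransform_eq_sum_range (t : F) (α : ℕ → F) {n N : ℕ} (hN : n < N) :
    baileyTransform t α n =
      ∑ r ∈ Finset.range N, α r * (pochInv t (n - r) * pochInv t (n + r + 1)) := by
  refine Finset.sum_subset (Finset.range_mono hN) fun r _ hr => ?_
  rw [Finset.mem_range] at hr
  rw [pochInv_of_neg t (by omega), zero_mul, mul_zero]

theorem baileyTransform_zero (t : F) (α : ℕ → F) : baileyTransform t α 0 = α 0 / (1 - t) := by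
  simp [baileyTransform, pochInv_zero, pochInv_one, div_eq_mul_inv]

/-- The sequence `α` of the unit Bailey pair. -/
def unitAlpha (t : F) (r : ℕ) : F := (-1) ^ r * t ^ tri (r - 1) * (1 - t ^ (2 * r + 1))

theorem one_sub_mul_sum_unitAlpha (ht : t ≠ 0) (h1 : ∀ k : ℕ, t ^ (k + 1) ≠ 1) (n : ℤ) (N : ℕ) :
    (1 - t ^ n) *
        ∑ r ∈ Finset.range N, unitAlpha t r * (pochInv t (n - r) * pochInv t (n + r + 1)) =
      -((-1) ^ N * t ^ tri (N - 1) * (1 - t ^ N) * (pochInv t (n - N) * pochInv t (n + N))) := by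
  induction N with
  | zero => simp
  | succ N ih =>
    have e1 := pochInv_sub_one h1 (n - N)
    have e2 := pochInv_sub_one h1 (n + N + 1)
    rw [add_sub_cancel_right] at e2
    rw [Finset.sum_range_succ, mul_add, ih, unitAlpha, Nat.cast_succ, ← sub_sub, ← add_assoc, e1,
      e2, add_sub_cancel_right, tri_sub_one]
    simp only [zpow_add₀ ht, zpow_sub₀ ht, zpow_one, zpow_natCast, pow_succ, pow_mul']
    field_simp
    ring

theorem baileyTransform_unitAlpha (ht : t ≠ 0) (h1 : ∀ k : ℕ, t ^ (k + 1) ≠ 1) (n : ℕ) :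
    baileyTransform t (unitAlpha t) n = if n = 0 then 1 else 0 := by
  rcases n with - | n
  · have : 1 - t ≠ 0 := sub_ne_zero.2 (by simpa using (h1 0).symm)
    simp [baileyTransform_zero, unitAlpha, tri, this]
  · have h := one_sub_mul_sum_unitAlpha ht h1 (n + 1 : ℕ) (n + 1 + 1)
    rw [pochInv_of_neg t (by omega), zero_mul, mul_zero, neg_zero, zpow_natCast] at h
    exact (mul_eq_zero.1 h).resolve_left (sub_ne_zero.2 (h1 n).symm)

theorem one_sub_mul_one_sub_eq (ht : t ≠ 0) (hxy : x * y = t) (n r : ℕ) :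
    (1 - t ^ ((n : ℤ) - r)) * (1 - t ^ ((n : ℤ) + r + 1)) =
      (1 - x * t ^ n) * (1 - y * t ^ n) -
        t ^ n * ((t ^ r)⁻¹ * ((1 - x * t ^ r) * (1 - y * t ^ r))) := by
  have hr : t ^ r ≠ 0 := pow_ne_zero _ ht
  simp only [zpow_add₀ ht, zpow_sub₀ ht, zpow_one, zpow_natCast]
  field_simp
  linear_combination (t ^ r - t ^ n) * t ^ r * t ^ n * hxy

theorem baileyTransform_recurrence (ht : t ≠ 0) (h1 : ∀ k : ℕ, t ^ (k + 1) ≠ 1) (hxy : x * y = t)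
    (α : ℕ → F) (n : ℕ) :
    baileyTransform t α n =
      (1 - x * t ^ (n + 1)) * (1 - y * t ^ (n + 1)) * baileyTransform t α (n + 1) -
        t ^ (n + 1) * baileyTransform t
          (fun r => (t ^ r)⁻¹ * ((1 - x * t ^ r) * (1 - y * t ^ r)) * α r) (n + 1) := by
  rw [baileyTransform_eq_sum_range t α (n.lt_succ_self.trans (n + 1).lt_succ_self),
    baileyTransform, baileyTransform, Finset.mul_sum, Finset.mul_sum, ← Finset.sum_sub_distrib]
  refine Finset.sum_congr rfl fun r _ => ?_
  have e1 := pochInv_sub_one h1 ((n + 1 : ℕ) - r)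
  have e2 := pochInv_sub_one h1 ((n + 1 : ℕ) + r + 1)
  rw [show (n : ℤ) - r = (n + 1 : ℕ) - r - 1 by push_cast; ring, e1,
    show (n : ℤ) + r + 1 = (n + 1 : ℕ) + r + 1 - 1 by push_cast; ring, e2]
  linear_combination α r * pochInv t ((n + 1 : ℕ) - r) * pochInv t ((n + 1 : ℕ) + r + 1) *
    one_sub_mul_one_sub_eq ht hxy (n + 1) r

/-- The sequence `α` of the Bailey pair whose `β n` is `1 / ∏ k ≤ n, (1 - x t ^ k) (1 - y t ^ k)`
when `x y = t`. -/
def partialFractionAlpha (t x y : F) (r : ℕ) : F :=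
  (-1) ^ r * t ^ tri r * ((1 - t ^ (2 * r + 1)) / ((1 - x * t ^ r) * (1 - y * t ^ r)))

theorem baileyTransform_partialFractionAlpha (ht : t ≠ 0) (h1 : ∀ k : ℕ, t ^ (k + 1) ≠ 1)
    (hxy : x * y = t) (hx : ∀ k : ℕ, 1 - x * t ^ k ≠ 0) (hy : ∀ k : ℕ, 1 - y * t ^ k ≠ 0) (n : ℕ) :
    baileyTransform t (partialFractionAlpha t x y) n =
      (∏ k ∈ Finset.range (n + 1), ((1 - x * t ^ k) * (1 - y * t ^ k)))⁻¹ := by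
  induction n with
  | zero =>
    have h2 : 1 - t ≠ 0 := sub_ne_zero.2 (by simpa using (h1 0).symm)
    simp [baileyTransform_zero, partialFractionAlpha, tri_zero, div_div_cancel_left', h2]
  | succ n ih =>
    have hα : (fun r => (t ^ r)⁻¹ * ((1 - x * t ^ r) * (1 - y * t ^ r)) *
        partialFractionAlpha t x y r) = unitAlpha t := by
      funext r
      have hD := mul_ne_zero (hx r) (hy r)
      rw [partialFractionAlpha, unitAlpha, tri_sub_one, zpow_sub₀ ht, zpow_natCast]
      generalize (1 - x * t ^ r) * (1 - y * t ^ r) = D at *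
      field_simp
    have hrec := baileyTransform_recurrence ht h1 hxy (partialFractionAlpha t x y) n
    rw [hα, baileyTransform_unitAlpha ht h1, if_neg n.succ_ne_zero, mul_zero, sub_zero] at hrec
    rw [Finset.prod_range_succ, mul_inv, ← ih, hrec,
      eq_mul_inv_iff_mul_eq₀ (mul_ne_zero (hx _) (hy _)), mul_comm]

end BaileyPair

section Jacobi

variable {F : Type*} [Field F] {t : F}

/-- The summand `(-1) ^ r t ^ (r (r + 1) / 2) / ((t; t)_{n-r} (t; t)_{n+r+1})` of the finite form of
Jacobi's identity for the cube of the Euler product. -/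
def jacobiTerm (t : F) (n r : ℤ) : F :=
  (-1) ^ r * t ^ tri r * (pochInv t (n - r) * pochInv t (n + r + 1))

theorem jacobiTerm_of_lt (t : F) {n r : ℤ} (h : n < r) : jacobiTerm t n r = 0 := by
  rw [jacobiTerm, pochInv_of_neg t (sub_neg.2 h), zero_mul, mul_zero]

theorem jacobiTerm_neg_one (t : F) (n : ℤ) : jacobiTerm t n (-1) = -jacobiTerm t n 0 := by
  rw [jacobiTerm, jacobiTerm, ← tri_neg_one_sub]
  simp [mul_comm]

theorem jacobiTerm_recurrence (ht : t ≠ 0) (h1 : ∀ k : ℕ, t ^ (k + 1) ≠ 1) (n r : ℤ) :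
    (1 - t ^ (2 * n + 2)) * (1 - t ^ (2 * n + 3)) * jacobiTerm t (n + 1) r =
      (1 + t ^ (2 * n + 2)) * jacobiTerm t n r -
        t ^ (n + 1) * (jacobiTerm t n (r - 1) + jacobiTerm t n (r + 1)) := by
  have a1 := pochInv_sub_one h1 (n + 1 - r)
  have a2 := pochInv_sub_one h1 (n + 1 - r - 1)
  have b1 := pochInv_sub_one h1 (n + r + 2)
  have b2 := pochInv_sub_one h1 (n + r + 2 - 1)
  unfold jacobiTerm
  rw [show n + 1 + r + 1 = n + r + 2 by ring, show n - (r - 1) = n + 1 - r by ring,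
    show n + (r - 1) + 1 = n + r + 2 - 1 - 1 by ring, show n - r = n + 1 - r - 1 by ring,
    show n + r + 1 = n + r + 2 - 1 by ring, show n - (r + 1) = n + 1 - r - 1 - 1 by ring,
    show n + (r + 1) + 1 = n + r + 2 by ring, b2, a2, a1, b1, tri_sub_one, tri_add_one]
  have hm : (-1 : F) ≠ 0 := by simp
  rw [show 2 * n + 2 = n + n + 1 + 1 by ring, show 2 * n + 3 = n + n + 1 + 1 + 1 by ring,
    show n + r + 2 = n + r + 1 + 1 by ring]
  simp only [zpow_add₀ ht, zpow_sub₀ ht, zpow_one, zpow_add₀ hm, zpow_sub₀ hm]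
  field_simp
  ring

theorem sum_jacobiTerm_second_difference (t : F) (n : ℤ) (N : ℕ) :
    ∑ r ∈ Finset.range N, (2 * r + 1 : F) *
        (jacobiTerm t n (r - 1) + jacobiTerm t n (r + 1) - 2 * jacobiTerm t n r) =
      (2 * N - 1) * jacobiTerm t n N - (2 * N + 1) * jacobiTerm t n (N - 1) := by
  induction N with
  | zero => simp [jacobiTerm_neg_one]
  | succ N ih =>
    rw [Finset.sum_range_succ, ih]
    push_cast
    rw [add_sub_cancel_right]
    ring

theorem sum_jacobiTerm_recurrence (ht : t ≠ 0) (h1 : ∀ k : ℕ, t ^ (k + 1) ≠ 1) {n N : ℕ}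
    (hN : n + 1 < N) :
    (1 - t ^ (2 * n + 2)) * (1 - t ^ (2 * n + 3)) *
        ∑ r ∈ Finset.range N, (2 * r + 1 : F) * jacobiTerm t (n + 1 : ℕ) r =
      (1 - t ^ (n + 1)) ^ 2 * ∑ r ∈ Finset.range N, (2 * r + 1 : F) * jacobiTerm t n r := by
  have hdiff := sum_jacobiTerm_second_difference t n N
  rw [jacobiTerm_of_lt t (by omega), jacobiTerm_of_lt t (by omega), mul_zero, mul_zero,
    sub_zero] at hdiff
  rw [← sub_zero ((1 - t ^ (n + 1)) ^ 2 * _), ← mul_zero (t ^ (n + 1)), ← hdiff, Finset.mul_sum,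
    Finset.mul_sum, Finset.mul_sum, ← Finset.sum_sub_distrib]
  refine Finset.sum_congr rfl fun r _ => ?_
  have hrec := jacobiTerm_recurrence ht h1 n r
  rw [show 2 * (n : ℤ) + 2 = (2 * n + 2 : ℕ) by push_cast; ring,
    show 2 * (n : ℤ) + 3 = (2 * n + 3 : ℕ) by push_cast; ring,
    show (n : ℤ) + 1 = (n + 1 : ℕ) by push_cast; ring] at hrec
  simp only [zpow_natCast] at hrec
  linear_combination (2 * r + 1 : F) * hrec

theorem sum_jacobiTerm (ht : t ≠ 0) (h1 : ∀ k : ℕ, t ^ (k + 1) ≠ 1) {n N : ℕ} (hN : n < N) :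
    ∑ r ∈ Finset.range N, (2 * r + 1 : F) * jacobiTerm t n r =
      poch t n ^ 2 / poch t (2 * n + 1) := by
  have hpos (k : ℕ) : 1 - t ^ (k + 1) ≠ 0 := sub_ne_zero.2 (h1 k).symm
  induction n with
  | zero =>
    rw [Finset.sum_eq_single_of_mem 0 (Finset.mem_range.2 hN) fun r _ hr => by
      rw [jacobiTerm_of_lt t (by omega), mul_zero]]
    simp [jacobiTerm, tri_zero, pochInv_zero, pochInv_one, poch]
  | succ n ih =>
    have h2 := hpos (2 * n + 1)
    have h3 := hpos (2 * n + 1 + 1)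
    have hrec := sum_jacobiTerm_recurrence ht h1 hN
    rw [ih (by omega)] at hrec
    rw [← mul_right_inj' (mul_ne_zero h2 h3), hrec,
      show 2 * (n + 1) + 1 = 2 * n + 1 + 1 + 1 by ring, poch_succ t n,
      poch_succ t (2 * n + 1 + 1), poch_succ t (2 * n + 1)]
    have h4 := poch_ne_zero h1 (2 * n + 1)
    field_simp

theorem baileyTransform_jacobi (ht : t ≠ 0) (h1 : ∀ k : ℕ, t ^ (k + 1) ≠ 1) (n : ℕ) :
    baileyTransform t (fun r => (2 * r + 1 : F) * ((-1) ^ r * t ^ tri r)) n =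
      poch t n ^ 2 / poch t (2 * n + 1) := by
  rw [← sum_jacobiTerm ht h1 n.lt_succ_self, baileyTransform]
  simp only [jacobiTerm, zpow_natCast, mul_assoc, Nat.succ_eq_add_one]

end Jacobi

section BaileyLimit

variable {K : Type*} [Field K] [Valued K ℤᵐ⁰] {t : K}

/-- The infinite product `(t; t)_∞`. -/
noncomputable def euler (t : K) : K := ∏' n : ℕ, (1 - t ^ (n + 1))

theorem valuation_poch (ht : OrdGE 1 t) (n : ℕ) : Valued.v (poch t n) = 1 := by
  rw [poch, map_prod]
  exact Finset.prod_eq_one fun k _ => (ht.pow_of_pos k.succ_pos).valuation_one_sub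

theorem ordGE_pochInv (ht : OrdGE 1 t) (m : ℤ) : OrdGE 0 (pochInv t m) := by
  rcases lt_or_ge m 0 with h | h
  · rw [pochInv_of_neg t h]
    exact ordGE_zero 0
  · lift m to ℕ using h
    rw [pochInv_natCast]
    exact ordGE_inv_of_valuation_eq_one (valuation_poch ht m)

theorem ordGE_pow_mul_pochInv (ht : OrdGE 1 t) {d e : ℕ} (h : d ≤ e) (m n : ℤ) :
    OrdGE d (t ^ e * (pochInv t m * pochInv t n)) :=
  ((ht.natCast_pow e).mono (Nat.cast_le.2 h)).mul_right
    ((ordGE_pochInv ht m).mul_right (ordGE_pochInv ht n))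

/-- The summand `t ^ (k (k + m)) / ((t; t)_k (t; t)_{k+m})` counting the partitions whose Durfee
rectangle has sides `k` and `k + m`. -/
def durfeeTerm {F : Type*} [Field F] (t : F) (m k : ℕ) : F :=
  t ^ (k * k + k * m) * (pochInv t k * pochInv t (k + m))

theorem durfeeTerm_recurrence (ht : OrdGE 1 t) (m k : ℕ) :
    durfeeTerm t m k - durfeeTerm t (m + 1) k + t ^ (m + 1) * durfeeTerm t (m + 1) k =
      t ^ (k * k + k * m) * (pochInv t (k - 1) * pochInv t (k + (m + 1 : ℕ))) := by
  have e1 := pochInv_sub_one ht.pow_succ_ne_one (k : ℤ)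
  have e2 := pochInv_sub_one ht.pow_succ_ne_one (k + m + 1 : ℕ)
  rw [show ((k + m + 1 : ℕ) : ℤ) - 1 = k + m by push_cast; ring] at e2
  rw [durfeeTerm, durfeeTerm, e1, e2,
    show (k + (m + 1 : ℕ) : ℤ) = (k + m + 1 : ℕ) by push_cast; ring]
  simp only [zpow_natCast]
  ring

theorem ordGE_durfeeTerm (ht : OrdGE 1 t) (m k : ℕ) : OrdGE k (durfeeTerm t m k) :=
  ordGE_pow_mul_pochInv ht (k.le_mul_self.trans (Nat.le_add_right _ _)) _ _

variable [CompleteSpace K]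

theorem multipliable_one_sub_pow_succ (ht : OrdGE 1 t) :
    Multipliable fun n : ℕ => 1 - t ^ (n + 1) := by
  simp only [sub_eq_add_neg]
  refine multipliable_one_add_of_summable_prod
    (summable_of_ordGE (e := fun s : Finset ℕ => ∑ i ∈ s, (i + 1 : ℤ)) ?_ fun s => ?_)
  · refine tendsto_atTop.2 fun D => eventually_cofinite.2
      ((Finset.range D.toNat).powerset.finite_toSet.subset fun s hs => ?_)
    refine Finset.mem_coe.2 (Finset.mem_powerset.2 fun i hi => Finset.mem_range.2 ?_)
    have hle := Finset.single_le_sum (f := fun i : ℕ => (i + 1 : ℤ)) (fun j _ => by positivity) hi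
    simp only [Set.mem_ofPred_eq, not_le] at hs
    omega
  · rw [Finset.prod_neg, Finset.prod_pow_eq_pow_sum]
    refine OrdGE.mul_left ?_ ((ht.natCast_pow _).mono (by push_cast; rfl))
    simpa using ordGE_neg_one_zpow (K := K) s.card

theorem tendsto_poch (ht : OrdGE 1 t) : Tendsto (poch t) atTop (𝓝 (euler t)) :=
  (multipliable_one_sub_pow_succ ht).tendsto_prod_tprod_nat

theorem euler_ne_zero (ht : OrdGE 1 t) : euler t ≠ 0 := by
  intro h0
  obtain ⟨n, hn⟩ := (tendsto_zero_iff_ordGE.1 (h0 ▸ tendsto_poch ht) 1).exists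
  exact hn.valuation_lt_one.ne (valuation_poch ht n)

theorem tendsto_pochInv (ht : OrdGE 1 t) {u : ℕ → ℤ} (hu : Tendsto u atTop atTop) :
    Tendsto (fun n => pochInv t (u n)) atTop (𝓝 (euler t)⁻¹) := by
  have hu' : Tendsto (fun n => (u n).toNat) atTop atTop :=
    tendsto_atTop.2 fun b => (hu.eventually_ge_atTop (b : ℤ)).mono fun n hn => by omega
  refine (((tendsto_poch ht).comp hu').inv₀ (euler_ne_zero ht)).congr' ?_
  filter_upwards [hu.eventually_ge_atTop 0] with n hn
  rw [pochInv, if_pos hn, Function.comp_apply]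

theorem tendsto_baileyTransform (ht : OrdGE 1 t) {α : ℕ → K} {e : ℕ → ℤ}
    (he : Tendsto e cofinite atTop) (hα : ∀ r, OrdGE (e r) (α r)) :
    Tendsto (baileyTransform t α) atTop (𝓝 ((∑' r, α r) * (euler t ^ 2)⁻¹)) := by
  have hsum (n : ℕ) : baileyTransform t α n =
      ∑' r : ℕ, α r * (pochInv t (n - r) * pochInv t (n + r + 1)) := by
    refine (tsum_eq_sum fun r hr => ?_).symm
    rw [Finset.mem_range] at hr
    rw [pochInv_of_neg t (m := n - r) (by omega), zero_mul, mul_zero]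
  rw [funext hsum, ← tsum_mul_right]
  refine tendsto_tsum_of_ordGE he (fun n r => (hα r).mul_right
    ((ordGE_pochInv ht _).mul_right (ordGE_pochInv ht _))) fun r => Tendsto.const_mul _ ?_
  rw [pow_two, mul_inv]
  refine (tendsto_pochInv ht ?_).mul (tendsto_pochInv ht ?_)
  · exact tendsto_atTop_add_const_right _ (-(r : ℤ)) tendsto_natCast_atTop_atTop
  · exact tendsto_atTop_add_const_right _ 1
      (tendsto_atTop_add_const_right _ (r : ℤ) tendsto_natCast_atTop_atTop)

/-- The generating function of partitions, summed over Durfee rectangles whose sides differ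
by `m`. -/
noncomputable def durfeeSum (t : K) (m : ℕ) : K := ∑' k : ℕ, durfeeTerm t m k

theorem summable_durfeeTerm (ht : OrdGE 1 t) (m : ℕ) : Summable (durfeeTerm t m) :=
  summable_of_ordGE tendsto_natCast_cofinite (ordGE_durfeeTerm ht m)

theorem durfeeSum_recurrence (ht : OrdGE 1 t) (m : ℕ) :
    durfeeSum t m - durfeeSum t (m + 1) =
      -t ^ (m + 1) * (durfeeSum t (m + 1) - durfeeSum t (m + 2)) := by
  have hs := (summable_durfeeTerm ht m).sub (summable_durfeeTerm ht (m + 1))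
  have hs' := (summable_durfeeTerm ht (m + 1)).mul_left (t ^ (m + 1))
  have hshift : ∑' k, (durfeeTerm t m k - durfeeTerm t (m + 1) k +
      t ^ (m + 1) * durfeeTerm t (m + 1) k) = t ^ (m + 1) * durfeeSum t (m + 2) := by
    rw [(hs.add hs').tsum_eq_zero_add, durfeeTerm_recurrence ht, Nat.cast_zero,
      pochInv_of_neg t (by omega), zero_mul (pochInv t _), mul_zero, zero_add, durfeeSum,
      ← tsum_mul_left]
    refine tsum_congr fun k => ?_
    rw [durfeeTerm_recurrence ht, durfeeTerm, Nat.cast_succ, add_sub_cancel_right,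
      show (k : ℤ) + 1 + (m + 1 : ℕ) = k + (m + 2 : ℕ) by push_cast; ring]
    ring
  rw [hs.tsum_add hs', (summable_durfeeTerm ht m).tsum_sub (summable_durfeeTerm ht (m + 1)),
    tsum_mul_left] at hshift
  unfold durfeeSum at *
  linear_combination hshift

theorem durfeeSum_eq_durfeeSum_zero (ht : OrdGE 1 t) (m : ℕ) : durfeeSum t m = durfeeSum t 0 := by
  have hord (D : ℕ) : ∀ m, OrdGE D (durfeeSum t m - durfeeSum t (m + 1)) := by
    induction D with
    | zero =>
      have hU (m) : OrdGE 0 (durfeeSum t m) :=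
        ordGE_tsum fun k => (ordGE_durfeeTerm ht m k).mono k.cast_nonneg
      exact fun m => (hU m).sub (hU (m + 1))
    | succ D ih =>
      intro m
      rw [durfeeSum_recurrence ht, Nat.cast_succ, add_comm]
      exact (ht.pow_of_pos m.succ_pos).neg.mul (ih (m + 1))
  induction m with
  | zero => rfl
  | succ m ih => rw [← ih, ← sub_eq_zero.1 (eq_zero_of_ordGE fun D => hord D m)]

theorem tendsto_durfeeSum (ht : OrdGE 1 t) : Tendsto (durfeeSum t) atTop (𝓝 (euler t)⁻¹) := by
  rw [← tsum_ite_eq (0 : ℕ) fun _ => (euler t)⁻¹]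
  refine tendsto_tsum_of_ordGE tendsto_natCast_cofinite (fun m k => ordGE_durfeeTerm ht m k)
    fun k => ?_
  rcases Nat.eq_zero_or_pos k with rfl | hk
  · simpa [durfeeTerm, pochInv_zero] using tendsto_pochInv ht tendsto_natCast_atTop_atTop
  · rw [if_neg hk.ne']
    refine tendsto_zero_of_ordGE tendsto_natCast_atTop_atTop fun m =>
      ordGE_pow_mul_pochInv ht ?_ _ _
    exact (Nat.le_mul_of_pos_left m hk).trans (Nat.le_add_left _ _)

theorem durfeeSum_eq (ht : OrdGE 1 t) (m : ℕ) : durfeeSum t m = (euler t)⁻¹ := by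
  rw [durfeeSum_eq_durfeeSum_zero ht]
  refine tendsto_nhds_unique ?_ (tendsto_durfeeSum ht)
  rw [funext (durfeeSum_eq_durfeeSum_zero ht)]
  exact tendsto_const_nhds

/-- **Bailey's lemma** with both parameters sent to infinity. -/
theorem hasSum_baileyTransform (ht : OrdGE 1 t) {α : ℕ → K} (hα : ∀ r, OrdGE 0 (α r)) :
    HasSum (fun n : ℕ => t ^ (n * n + n) * baileyTransform t α n)
      ((∑' r : ℕ, t ^ (r * r + r) * α r) * (euler t)⁻¹) := by
  let F (p : ℕ × ℕ) : K := α p.1 * (t ^ ((p.1 + p.2) * (p.1 + p.2) + (p.1 + p.2)) *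
    (pochInv t p.2 * pochInv t (2 * p.1 + p.2 + 1)))
  have hF : Summable F := by
    refine summable_of_ordGE (tendsto_add_cofinite_of_nonneg tendsto_natCast_cofinite
      tendsto_natCast_cofinite Nat.cast_nonneg Nat.cast_nonneg) fun p => (hα p.1).mul_left ?_
    rw [← Nat.cast_add]
    exact ordGE_pow_mul_pochInv ht (Nat.le_add_left _ _) _ _
  have hfiber (r : ℕ) : HasSum (fun k => F (r, k)) (t ^ (r * r + r) * α r * (euler t)⁻¹) := by
    rw [← durfeeSum_eq ht (2 * r + 1)]
    refine ((summable_durfeeTerm ht _).hasSum.mul_left (t ^ (r * r + r) * α r)).congr_fun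
      fun k => ?_
    rw [durfeeTerm, show (k : ℤ) + (2 * r + 1 : ℕ) = 2 * r + k + 1 by push_cast; ring]
    simp only [F]
    ring
  have hdiag := (Finset.HasAntidiagonal.sigmaAntidiagonalEquivProd (A := ℕ)).hasSum_iff.2 hF.hasSum
  rw [← tsum_mul_right, (hF.hasSum.prod_fiberwise hfiber).tsum_eq]
  refine (hdiag.sigma fun n => hasSum_fintype _).congr_fun fun n => ?_
  refine Eq.symm ((Finset.sum_coe_sort (Finset.HasAntidiagonal.antidiagonal n) F).trans ?_)
  rw [Finset.Nat.sum_antidiagonal_eq_sum_range_succ_mk, baileyTransform, Finset.mul_sum]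
  refine Finset.sum_congr rfl fun r hr => ?_
  have hrn : r ≤ n := Finset.mem_range_succ_iff.1 hr
  simp only [F]
  rw [Nat.add_sub_cancel' hrn, Nat.cast_sub hrn,
    show 2 * (r : ℤ) + (n - r) + 1 = n + r + 1 by ring]
  ring

end BaileyLimit

section NegOne

variable {F : Type*} [Field F]

theorem neg_one_zpow_neg (k : ℤ) : (-1 : F) ^ (-k) = (-1) ^ k := by
  rw [zpow_neg, ← inv_zpow, inv_neg_one]

theorem neg_one_zpow_neg_one_sub (k : ℤ) : (-1 : F) ^ (-1 - k) = -(-1) ^ k := by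
  rw [show -1 - k = -(k + 1) by ring, neg_one_zpow_neg, zpow_add_one₀ (neg_ne_zero.2 one_ne_zero),
    mul_neg_one]

end NegOne

section Annulus

variable {K : Type*} [Field K] [Valued K ℤᵐ⁰] {Q x z : K}

/-- The element `z` lies in the annulus `0 < |Q| < |z| < 1`, on which the bilateral series below
converge. -/
structure InAnnulus (Q z : K) : Prop where
  base_ne_zero : Q ≠ 0
  ne_zero : z ≠ 0
  ordGE_one : OrdGE 1 z
  ordGE_one_div : OrdGE 1 (Q / z)

theorem InAnnulus.base_div (hz : InAnnulus Q z) : InAnnulus Q (Q / z) where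
  base_ne_zero := hz.base_ne_zero
  ne_zero := div_ne_zero hz.base_ne_zero hz.ne_zero
  ordGE_one := hz.ordGE_one_div
  ordGE_one_div := by rw [div_div_cancel₀ hz.base_ne_zero]; exact hz.ordGE_one

theorem InAnnulus.ordGE_base (hz : InAnnulus Q z) : OrdGE 1 Q := by
  rw [← mul_div_cancel₀ Q hz.ne_zero]
  exact (hz.ordGE_one.mul hz.ordGE_one_div).mono one_le_two

theorem InAnnulus.pow (hz : InAnnulus Q z) {n : ℕ} (hn : 0 < n) :
    InAnnulus (Q ^ n) (z ^ n) where
  base_ne_zero := pow_ne_zero _ hz.base_ne_zero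
  ne_zero := pow_ne_zero _ hz.ne_zero
  ordGE_one := hz.ordGE_one.pow_of_pos hn
  ordGE_one_div := by rw [← div_pow]; exact hz.ordGE_one_div.pow_of_pos hn

theorem inv_one_sub_mul_zpow_neg_one_sub {F : Type*} [Field F] {Q x : F} (hQ : Q ≠ 0) (hx : x ≠ 0)
    (k : ℤ) : (1 - x * Q ^ (-1 - k))⁻¹ = -(Q / x * Q ^ k * (1 - Q / x * Q ^ k)⁻¹) := by
  have hQk : Q ^ k ≠ 0 := zpow_ne_zero k hQ
  have hneg : 1 - x * Q ^ (-1 - k) = -((Q / x * Q ^ k)⁻¹ * (1 - Q / x * Q ^ k)) := by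
    rw [zpow_sub₀ hQ, zpow_neg_one]
    field_simp
    ring
  rw [hneg, inv_neg, mul_inv, inv_inv]

theorem InAnnulus.one_sub_mul_zpow_ne_zero (hx : InAnnulus Q x) (k : ℤ) : 1 - x * Q ^ k ≠ 0 := by
  rcases le_or_gt 0 k with hk | hk
  · exact (hx.ordGE_one.mul_zpow hx.ordGE_base hk).one_sub_ne_zero
  · obtain ⟨m, rfl⟩ : ∃ m, k = -1 - m := ⟨-1 - k, by ring⟩
    have hm : OrdGE 1 (Q / x * Q ^ m) := hx.ordGE_one_div.mul_zpow hx.ordGE_base (by omega)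
    refine inv_eq_zero.not.1 ?_
    rw [inv_one_sub_mul_zpow_neg_one_sub hx.base_ne_zero hx.ne_zero]
    exact neg_ne_zero.2 (mul_ne_zero (mul_ne_zero hx.base_div.ne_zero
      (zpow_ne_zero _ hx.base_ne_zero)) (inv_ne_zero hm.one_sub_ne_zero))

theorem InAnnulus.ordGE_mul_inv_one_sub_of_neg (hx : InAnnulus Q x) {k : ℤ} (hk : k < 0) :
    OrdGE (-k) (x * (1 - x * Q ^ k)⁻¹) := by
  obtain ⟨m, rfl⟩ : ∃ m, k = -1 - m := ⟨-1 - k, by ring⟩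
  have hm : OrdGE 1 (Q / x * Q ^ m) := hx.ordGE_one_div.mul_zpow hx.ordGE_base (by omega)
  have heq : x * (1 - x * Q ^ (-1 - m))⁻¹ = -(Q * Q ^ m * (1 - Q / x * Q ^ m)⁻¹) := by
    have := hx.ne_zero
    rw [inv_one_sub_mul_zpow_neg_one_sub hx.base_ne_zero this]
    field_simp
  rw [heq, neg_sub, sub_neg_eq_add, add_comm]
  exact ((hx.ordGE_base.mul (hx.ordGE_base.zpow (by omega))).mul_right hm.inv_one_sub).neg

theorem InAnnulus.ordGE_mul_inv_one_sub (hx : InAnnulus Q x) (k : ℤ) :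
    OrdGE 0 (x * (1 - x * Q ^ k)⁻¹) := by
  rcases le_or_gt 0 k with hk | hk
  · exact (hx.ordGE_one.mono zero_le_one).mul_left
      (hx.ordGE_one.mul_zpow hx.ordGE_base hk).inv_one_sub
  · exact (hx.ordGE_mul_inv_one_sub_of_neg hk).mono (neg_nonneg.2 hk.le)

theorem InAnnulus.ordGE_abs_kroneckerTerm (hx : InAnnulus Q x) (hz : InAnnulus Q z) (k : ℤ) :
    OrdGE |k| (x * (z ^ k * (1 - x * Q ^ k)⁻¹)) := by
  rcases le_or_gt 0 k with hk | hk
  · rw [abs_of_nonneg hk, mul_left_comm]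
    exact (hz.ordGE_one.zpow hk).mul_right (hx.ordGE_mul_inv_one_sub k)
  · obtain ⟨m, rfl⟩ : ∃ m, k = -1 - m := ⟨-1 - k, by ring⟩
    have hm : OrdGE 1 (Q / x * Q ^ m) := hx.ordGE_one_div.mul_zpow hx.ordGE_base (by omega)
    have heq : x * (z ^ (-1 - m) * (1 - x * Q ^ (-1 - m))⁻¹) =
        -((Q / z) ^ (1 + m) * (1 - Q / x * Q ^ m)⁻¹) := by
      have hx0 := hx.ne_zero
      have hz0 := hz.ne_zero
      rw [inv_one_sub_mul_zpow_neg_one_sub hx.base_ne_zero hx0, div_zpow,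
        zpow_one_add₀ hx.base_ne_zero, show -1 - m = -(1 + m) by ring, zpow_neg]
      field_simp
    rw [heq, abs_of_neg hk, neg_sub, sub_neg_eq_add, add_comm m]
    exact ((hz.ordGE_one_div.zpow (by omega)).mul_right hm.inv_one_sub).neg

end Annulus

section Bilateral

variable {K : Type*} [Field K] [Valued K ℤᵐ⁰] {Q x z : K}

/-- The theta function `∑ j, (-1) ^ j Q ^ (j (j - 1) / 2) z ^ j`. -/
noncomputable def theta (Q z : K) : K := ∑' j : ℤ, (-1) ^ j * Q ^ tri (j - 1) * z ^ j

/-- The Appell–Lerch sum `∑ k, (-1) ^ k Q ^ (ℓ k (k + 1) / 2) z ^ k / (1 - x Q ^ k)` of level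
`ℓ`. -/
noncomputable def appellLerch (ℓ : ℕ) (Q x z : K) : K :=
  ∑' k : ℤ, (-1) ^ k * Q ^ (ℓ * tri k) * z ^ k * (1 - x * Q ^ k)⁻¹

/-- Kronecker's bilateral series `∑ k, z ^ k / (1 - x Q ^ k)`. -/
noncomputable def kroneckerSum (Q x z : K) : K := ∑' k : ℤ, z ^ k * (1 - x * Q ^ k)⁻¹

theorem exists_ordGE_neg_natCast (f : K) : ∃ N : ℕ, OrdGE (-N : ℤ) f := by
  rcases eq_or_ne f 0 with rfl | hf
  · exact ⟨0, ordGE_zero _⟩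
  · refine ⟨(log (Valued.v f)).toNat, ?_⟩
    rw [OrdGE, neg_neg, ← log_le_iff_le_exp ((Valuation.ne_zero_iff _).2 hf)]
    exact Int.self_le_toNat _

theorem exists_ordGE_zpow (z : K) : ∃ N : ℕ, ∀ k : ℤ, OrdGE (-(N * |k|)) (z ^ k) := by
  obtain ⟨N, hN⟩ := exists_ordGE_neg_natCast z
  obtain ⟨M, hM⟩ := exists_ordGE_neg_natCast z⁻¹
  refine ⟨N + M, fun k => ?_⟩
  rcases Int.natAbs_eq k with hk | hk
  · rw [hk, zpow_natCast]
    exact (hN.pow _).mono (by push_cast; rw [abs_abs]; nlinarith [abs_nonneg k])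
  · rw [hk, zpow_neg, zpow_natCast, ← inv_pow]
    exact (hM.pow _).mono (by push_cast; rw [abs_neg, abs_abs]; nlinarith [abs_nonneg k])

theorem theta_base_div (hQ0 : Q ≠ 0) (z : K) : theta Q (Q / z) = theta Q z := by
  rw [theta, ← (Equiv.neg ℤ).tsum_eq]
  refine tsum_congr fun j => ?_
  rw [Equiv.neg_apply, show -j - 1 = -1 - j by ring, tri_neg_one_sub, tri_sub_one, zpow_sub₀ hQ0,
    div_zpow, zpow_neg Q, zpow_neg z, neg_one_zpow_neg]
  field_simp

theorem tsum_int_eq_tsum_nat {f : ℤ → K} (hf : Summable f) :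
    ∑' k, f k = ∑' r : ℕ, (f r + f (-1 - r)) := by
  rw [← tsum_nat_add_neg_add_one hf]
  simp only [neg_add_rev, ← sub_eq_add_neg]

variable [CompleteSpace K]

theorem summable_mul_ordGE {ι : Type*} {f g : ι → K} (hf : Summable f) (hg : ∀ i, OrdGE 0 (g i)) :
    Summable fun i => f i * g i := by
  refine NonarchimedeanAddGroup.summable_of_tendsto_cofinite_zero
    (tendsto_zero_iff_ordGE.2 fun D => ?_)
  filter_upwards [tendsto_zero_iff_ordGE.1 hf.tendsto_cofinite_zero D] with i hi
  exact hi.mul_right (hg i)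

theorem summable_zpow_mul_tri (hQ : OrdGE 1 Q) (z : K) {ℓ : ℕ} (hℓ : 0 < ℓ) :
    Summable fun k : ℤ => (-1) ^ k * Q ^ (ℓ * tri k) * z ^ k := by
  obtain ⟨N, hN⟩ := exists_ordGE_zpow z
  refine summable_of_ordGE (e := fun k => |k| + -((N + 2) ^ 2))
    (tendsto_atTop_add_const_right _ _ tendsto_abs_cofinite) fun k => ?_
  have htri : tri k ≤ ℓ * tri k := le_mul_of_one_le_left (tri_nonneg k) (by omega)
  refine (((ordGE_neg_one_zpow k).mul_left
    ((hQ.zpow ((tri_nonneg k).trans htri)).mono htri)).mul (hN k)).mono ?_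
  -- twice the difference of both sides is at least `(|k| - (N + 2)) ^ 2 + |k|`
  nlinarith [two_mul_tri k, sq_abs k, neg_abs_le k, sq_nonneg (|k| - (N + 2)), abs_nonneg k]

theorem summable_theta (hQ : OrdGE 1 Q) (hQ0 : Q ≠ 0) (z : K) :
    Summable fun j : ℤ => (-1) ^ j * Q ^ tri (j - 1) * z ^ j := by
  refine (summable_zpow_mul_tri hQ (z / Q) one_pos).congr fun j => ?_
  rw [tri_sub_one, zpow_sub₀ hQ0, div_zpow, Nat.cast_one, one_mul]
  ring

theorem InAnnulus.summable_mul_inv_one_sub (hx : InAnnulus Q x) {f : ℤ → K} (hf : Summable f) :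
    Summable fun k => f k * (1 - x * Q ^ k)⁻¹ := by
  refine ((summable_mul_ordGE hf hx.ordGE_mul_inv_one_sub).mul_left x⁻¹).congr fun k => ?_
  have := hx.ne_zero
  field_simp

theorem InAnnulus.summable_appellLerch (hx : InAnnulus Q x) (z : K) {ℓ : ℕ} (hℓ : 0 < ℓ) :
    Summable fun k : ℤ => (-1) ^ k * Q ^ (ℓ * tri k) * z ^ k * (1 - x * Q ^ k)⁻¹ :=
  hx.summable_mul_inv_one_sub (summable_zpow_mul_tri hx.ordGE_base z hℓ)

theorem InAnnulus.summable_kroneckerSum (hx : InAnnulus Q x) (hz : InAnnulus Q z) :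
    Summable fun k : ℤ => z ^ k * (1 - x * Q ^ k)⁻¹ :=
  ((summable_of_ordGE tendsto_abs_cofinite (hx.ordGE_abs_kroneckerTerm hz)).mul_left x⁻¹).congr
    fun _ => inv_mul_cancel_left₀ hx.ne_zero _

theorem theta_base (hQ : OrdGE 1 Q) (hQ0 : Q ≠ 0) : theta Q Q = 0 := by
  rw [theta, tsum_int_eq_tsum_nat (summable_theta hQ hQ0 Q), ← tsum_zero (β := ℕ)]
  refine tsum_congr fun r => ?_
  simp only [tri_sub_one, tri_neg_one_sub, neg_one_zpow_neg_one_sub, zpow_sub₀ hQ0]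
  field_simp
  ring

end Bilateral

section EulerJacobi

variable {K : Type*} [Field K] [Valued K ℤᵐ⁰] [CompleteSpace K] {t : K}

/-- **Euler's pentagonal number theorem**, from the unit Bailey pair. -/
theorem theta_pow_three_sq (ht : OrdGE 1 t) (ht0 : t ≠ 0) : theta (t ^ 3) (t ^ 2) = euler t := by
  have hα (r : ℕ) : OrdGE 0 (unitAlpha t r) :=
    ((ordGE_neg_one_pow r).mul_left ((ht.zpow (tri_nonneg _)).mono (tri_nonneg _))).mul_right
      (ordGE_one.sub ((ht.natCast_pow _).mono (Nat.cast_nonneg _)))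
  have hsum := hasSum_baileyTransform ht hα
  simp only [baileyTransform_unitAlpha ht0 ht.pow_succ_ne_one, mul_ite, mul_one, mul_zero] at hsum
  have hone := hsum.tsum_eq
  rw [tsum_eq_single 0 fun n hn => if_neg hn, if_pos rfl, mul_zero, pow_zero,
    eq_mul_inv_iff_mul_eq₀ (euler_ne_zero ht), one_mul] at hone
  rw [hone, theta, tsum_int_eq_tsum_nat
    (summable_theta (ht.pow_of_pos three_pos) (pow_ne_zero 3 ht0) (t ^ 2))]
  refine tsum_congr fun r => ?_
  have htri : (t ^ 3) ^ tri r = t ^ (r * r + r) * t ^ tri r := by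
    rw [← zpow_natCast t 3, ← zpow_natCast t (r * r + r), ← zpow_mul, ← zpow_add₀ ht0]
    congr 1
    push_cast
    linarith [two_mul_tri r]
  rw [unitAlpha, neg_one_zpow_neg_one_sub]
  rw [show (-1 : ℤ) - r - 1 = -1 - (r + 1) by ring, tri_neg_one_sub, tri_add_one, tri_sub_one]
  have ht3 := pow_ne_zero 3 ht0
  have ht2 := pow_ne_zero 2 ht0
  simp only [zpow_sub₀ ht3, zpow_sub₀ ht2, zpow_add₀ ht3, zpow_sub₀ ht0, htri, zpow_one,
    zpow_neg_one, zpow_natCast]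
  field_simp
  ring

/-- **Jacobi's identity** for the cube of the Euler product. -/
theorem tsum_int_mul_tri (ht : OrdGE 1 t) (ht0 : t ≠ 0) :
    ∑' k : ℤ, (-1) ^ k * t ^ tri k * (k : K) = euler t ^ 3 := by
  have hα (r : ℕ) : OrdGE r ((2 * r + 1 : K) * ((-1) ^ r * t ^ tri r)) := by
    refine OrdGE.mul_left (by simpa using ordGE_intCast (K := K) (2 * r + 1)) ?_
    exact (ordGE_neg_one_pow r).mul_left ((ht.zpow (tri_nonneg _)).mono self_le_tri)
  have hlim := tendsto_baileyTransform ht tendsto_natCast_cofinite hα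
  rw [funext (baileyTransform_jacobi ht0 ht.pow_succ_ne_one)] at hlim
  have hlim' : Tendsto (fun n => poch t n ^ 2 / poch t (2 * n + 1)) atTop
      (𝓝 (euler t ^ 2 / euler t)) :=
    ((tendsto_poch ht).pow 2).div ((tendsto_poch ht).comp
      (tendsto_atTop_mono (fun n => show n ≤ 2 * n + 1 by omega) tendsto_id)) (euler_ne_zero ht)
  have heq := tendsto_nhds_unique hlim hlim'
  have hs : Summable fun k : ℤ => (-1) ^ k * t ^ tri k * (k : K) := by
    refine summable_mul_ordGE ?_ ordGE_intCast
    simpa using summable_zpow_mul_tri ht 1 one_pos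
  have he := euler_ne_zero ht
  rw [mul_inv_eq_iff_eq_mul₀ (pow_ne_zero 2 he)] at heq
  rw [tsum_int_eq_tsum_nat hs, ← show euler t ^ 2 / euler t * euler t ^ 2 = euler t ^ 3 by
    field_simp, ← heq]
  refine tsum_congr fun r => ?_
  rw [neg_one_zpow_neg_one_sub, tri_neg_one_sub, zpow_natCast]
  push_cast
  ring

end EulerJacobi

section AppellBailey

theorem prod_mul_poch_pow_three {F : Type*} [Field F] (t : F) (n : ℕ) :
    (∏ k ∈ Finset.range n, ((1 - t * (t ^ 3) ^ k) * (1 - t ^ 2 * (t ^ 3) ^ k))) *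
      poch (t ^ 3) n = poch t (3 * n) := by
  induction n with
  | zero => simp [poch]
  | succ n ih =>
    rw [Finset.prod_range_succ, poch_succ, show 3 * (n + 1) = 3 * n + 1 + 1 + 1 by ring,
      poch_succ, poch_succ, poch_succ, ← ih]
    ring

variable {K : Type*} [Field K] [Valued K ℤᵐ⁰] {t x : K}

theorem InAnnulus.one_sub_mul_pow_ne_zero (hx : InAnnulus t x) (k : ℕ) : 1 - x * t ^ k ≠ 0 := by
  simpa only [zpow_natCast] using hx.one_sub_mul_zpow_ne_zero k

theorem InAnnulus.baileyTransform_partialFractionAlpha (hx : InAnnulus t x) (n : ℕ) :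
    baileyTransform t (partialFractionAlpha t x (t / x)) n =
      (∏ k ∈ Finset.range (n + 1), ((1 - x * t ^ k) * (1 - t / x * t ^ k)))⁻¹ :=
  MockTheta.baileyTransform_partialFractionAlpha hx.base_ne_zero hx.ordGE_base.pow_succ_ne_one
    (mul_div_cancel₀ t hx.ne_zero) hx.one_sub_mul_pow_ne_zero hx.base_div.one_sub_mul_pow_ne_zero n

theorem InAnnulus.inv_one_sub_sub_inv_one_sub (hx : InAnnulus t x) (r : ℕ) :
    (1 - x * t ^ (r : ℤ))⁻¹ - (1 - x * t ^ (-1 - r : ℤ))⁻¹ =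
      (1 - t ^ (2 * r + 1)) / ((1 - x * t ^ r) * (1 - t / x * t ^ r)) := by
  have ha := hx.one_sub_mul_pow_ne_zero r
  have hb := hx.base_div.one_sub_mul_pow_ne_zero r
  rw [inv_one_sub_mul_zpow_neg_one_sub hx.base_ne_zero hx.ne_zero, zpow_natCast,
    show t ^ (2 * r + 1) = x * t ^ r * (t / x * t ^ r) by
      rw [mul_mul_mul_comm, mul_div_cancel₀ t hx.ne_zero]; ring]
  generalize x * t ^ r = a, t / x * t ^ r = b at *
  field_simp
  ring

theorem InAnnulus.ordGE_partialFractionAlpha (hx : InAnnulus t x) (r : ℕ) :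
    OrdGE r (partialFractionAlpha t x (t / x) r) := by
  rw [partialFractionAlpha, div_eq_mul_inv, mul_inv]
  exact ((ordGE_neg_one_pow r).mul_left ((hx.ordGE_base.zpow (tri_nonneg _)).mono
    self_le_tri)).mul_right ((MockTheta.ordGE_one.sub ((hx.ordGE_base.natCast_pow _).mono
    (Nat.cast_nonneg _))).mul_left ((hx.ordGE_one.mul_pow hx.ordGE_base r).inv_one_sub.mul_left
    (hx.ordGE_one_div.mul_pow hx.ordGE_base r).inv_one_sub))

theorem inAnnulus_pow_pow (ht : OrdGE 1 t) (ht0 : t ≠ 0) {m n : ℕ} (hm : 0 < m) (hmn : m < n) :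
    InAnnulus (t ^ n) (t ^ m) where
  base_ne_zero := pow_ne_zero n ht0
  ne_zero := pow_ne_zero m ht0
  ordGE_one := ht.pow_of_pos hm
  ordGE_one_div := by
    rw [div_eq_mul_inv, ← pow_sub₀ t ht0 hmn.le]
    exact ht.pow_of_pos (Nat.sub_pos_of_lt hmn)

theorem inAnnulus_pow_three (ht : OrdGE 1 t) (ht0 : t ≠ 0) : InAnnulus (t ^ 3) t := by
  simpa only [pow_one] using inAnnulus_pow_pow ht ht0 one_pos (show 1 < 3 by norm_num)

theorem inAnnulus_pow_three_sq (ht : OrdGE 1 t) (ht0 : t ≠ 0) : InAnnulus (t ^ 3) (t ^ 2) :=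
  inAnnulus_pow_pow ht ht0 two_pos (Nat.lt_succ_self 2)

variable [CompleteSpace K]

theorem InAnnulus.tsum_mul_partialFractionAlpha (hx : InAnnulus t x) (ℓ : ℕ) :
    ∑' r : ℕ, t ^ (ℓ * tri r) * partialFractionAlpha t x (t / x) r =
      appellLerch (ℓ + 1) t x 1 := by
  rw [appellLerch, tsum_int_eq_tsum_nat (hx.summable_appellLerch 1 ℓ.succ_pos)]
  refine tsum_congr fun r => ?_
  rw [partialFractionAlpha, ← hx.inv_one_sub_sub_inv_one_sub, tri_neg_one_sub,
    neg_one_zpow_neg_one_sub, one_zpow, one_zpow, zpow_natCast (-1 : K), Nat.cast_succ, add_one_mul,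
    zpow_add₀ hx.base_ne_zero]
  ring

theorem InAnnulus.hasSum_appellLerch_three (hx : InAnnulus t x) :
    HasSum (fun n : ℕ => t ^ (n * n + n) *
        (∏ k ∈ Finset.range (n + 1), ((1 - x * t ^ k) * (1 - t / x * t ^ k)))⁻¹)
      (appellLerch 3 t x 1 * (euler t)⁻¹) := by
  have hsum := hasSum_baileyTransform hx.ordGE_base fun r =>
    (hx.ordGE_partialFractionAlpha r).mono r.cast_nonneg
  have htri (r : ℕ) : t ^ (r * r + r) = t ^ ((2 : ℕ) * tri r) := by
    rw [← zpow_natCast, Nat.cast_two, two_mul_tri]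
    push_cast
    ring_nf
  simpa only [hx.baileyTransform_partialFractionAlpha, htri,
    hx.tsum_mul_partialFractionAlpha 2] using hsum

theorem InAnnulus.tendsto_appellLerch_one (hx : InAnnulus t x) :
    Tendsto (fun n : ℕ =>
        (∏ k ∈ Finset.range (n + 1), ((1 - x * t ^ k) * (1 - t / x * t ^ k)))⁻¹) atTop
      (𝓝 (appellLerch 1 t x 1 * (euler t ^ 2)⁻¹)) := by
  have hsum := tendsto_baileyTransform hx.ordGE_base tendsto_natCast_cofinite
    hx.ordGE_partialFractionAlpha
  have heq := hx.tsum_mul_partialFractionAlpha 0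
  simp only [Nat.cast_zero, zero_mul, zpow_zero, one_mul, zero_add] at heq
  rwa [funext hx.baileyTransform_partialFractionAlpha, heq] at hsum

theorem appellLerch_pow_three_self (ht : OrdGE 1 t) (ht0 : t ≠ 0) :
    appellLerch 1 (t ^ 3) t 1 * euler t = euler (t ^ 3) ^ 3 := by
  have ht3 : OrdGE 1 (t ^ 3) := ht.pow_of_pos three_pos
  have hlim := (inAnnulus_pow_three ht ht0).tendsto_appellLerch_one
  have hlim' := (((tendsto_poch ht).comp (tendsto_atTop_mono
    (fun n => show n ≤ 3 * (n + 1) by omega) tendsto_id)).inv₀ (euler_ne_zero ht)).mul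
      ((tendsto_poch ht3).comp (tendsto_add_atTop_nat 1))
  have heq := tendsto_nhds_unique hlim (hlim'.congr fun n => ?_)
  · have he := euler_ne_zero ht
    have he3 := euler_ne_zero ht3
    field_simp at heq
    exact heq
  · have hp := poch_ne_zero ht3.pow_succ_ne_one (n + 1)
    rw [show t ^ 3 / t = t ^ 2 by field_simp, Function.comp_apply, Function.comp_apply,
      ← prod_mul_poch_pow_three, mul_inv, inv_mul_cancel_right₀ hp]

end AppellBailey

section Convolution

variable {K : Type*} [Field K] [Valued K ℤᵐ⁰] {Q x z : K}

/-- The shear `(m, k) ↦ (m - k, k)`, which groups the terms of a product of two bilateral series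
by the total exponent `m`. -/
def shearEquiv : ℤ × ℤ ≃ ℤ × ℤ where
  toFun p := (p.1 - p.2, p.2)
  invFun p := (p.1 + p.2, p.2)
  left_inv p := by simp
  right_inv p := by simp

/-- The coefficient of `z ^ m` in the product of `theta Q z` with the series `∑ k, z ^ k * g k`. -/
noncomputable def thetaConv (Q : K) (g : ℤ → K) (m : ℤ) : K :=
  ∑' k : ℤ, (-1) ^ (m - k) * Q ^ tri (m - k - 1) * g k

theorem thetaConv_zero (Q : K) (g : ℤ → K) :
    thetaConv Q g 0 = ∑' k : ℤ, (-1) ^ k * Q ^ tri k * g k := by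
  refine tsum_congr fun k => ?_
  rw [show 0 - k - 1 = -1 - k by ring, tri_neg_one_sub, zero_sub, neg_one_zpow_neg]

theorem eq_of_homogeneous_recurrence {F : Type*} [Field F] {Q x : F} (hQ : Q ≠ 0) (hx : x ≠ 0)
    {y : ℤ → F} (h : ∀ m, y (m + 1) + x * Q ^ m * y m = 0) (m : ℤ) :
    y m = (-1) ^ m * Q ^ tri (m - 1) * x ^ m * y 0 := by
  have hm : (-1 : F) ≠ 0 := neg_ne_zero.2 one_ne_zero
  have hsol (i : ℤ) : (-1) ^ (i + 1) * Q ^ tri (i + 1 - 1) * x ^ (i + 1) * y 0 =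
      -(x * Q ^ i) * ((-1) ^ i * Q ^ tri (i - 1) * x ^ i * y 0) := by
    rw [add_sub_cancel_right, zpow_add_one₀ hm, zpow_add_one₀ hx, tri_sub_one, zpow_sub₀ hQ]
    field_simp
  induction m using Int.induction_on with
  | zero => simp [show tri (-1) = 0 from rfl]
  | succ i ih => rw [hsol, ← ih, ← sub_eq_zero, ← h i]; ring
  | pred i ih =>
    have hne : -(x * Q ^ (-(i : ℤ) - 1)) ≠ 0 := neg_ne_zero.2 (mul_ne_zero hx (zpow_ne_zero _ hQ))
    have hi := h (-i - 1)
    rw [sub_add_cancel] at hi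
    rw [← mul_right_inj' hne, ← hsol, sub_add_cancel, ← ih]
    linear_combination -hi

theorem hasSum_mul_shear {f g : ℤ → K} {a b : K} (hf : HasSum f a) (hg : HasSum g b) :
    HasSum (fun p : ℤ × ℤ => f (p.1 - p.2) * g p.2) (a * b) :=
  shearEquiv.hasSum_iff.2 (hf.mul_of_nonarchimedean hg)

variable [CompleteSpace K]

theorem hasSum_theta_mul (hQ : OrdGE 1 Q) (hQ0 : Q ≠ 0) (hz : z ≠ 0) {g : ℤ → K}
    (hg : Summable fun k => z ^ k * g k) :
    HasSum (fun p : ℤ × ℤ => z ^ p.1 * ((-1) ^ (p.1 - p.2) * Q ^ tri (p.1 - p.2 - 1) * g p.2))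
      (theta Q z * ∑' k, z ^ k * g k) := by
  rw [theta]
  convert hasSum_mul_shear (summable_theta hQ hQ0 z).hasSum hg.hasSum using 2 with p
  rw [zpow_sub₀ hz]
  have := zpow_ne_zero p.2 hz
  field_simp

theorem summable_thetaConv (hQ : OrdGE 1 Q) (hQ0 : Q ≠ 0) (hz : z ≠ 0) {g : ℤ → K}
    (hg : Summable fun k => z ^ k * g k) (m : ℤ) :
    Summable fun k => (-1) ^ (m - k) * Q ^ tri (m - k - 1) * g k := by
  have h := ((hasSum_theta_mul hQ hQ0 hz hg).summable.prod_factor m).mul_left (z ^ m)⁻¹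
  simpa only [inv_mul_cancel_left₀ (zpow_ne_zero m hz)] using h

theorem hasSum_thetaConv (hQ : OrdGE 1 Q) (hQ0 : Q ≠ 0) (hz : z ≠ 0) {g : ℤ → K}
    (hg : Summable fun k => z ^ k * g k) :
    HasSum (fun m => z ^ m * thetaConv Q g m) (theta Q z * ∑' k, z ^ k * g k) :=
  (hasSum_theta_mul hQ hQ0 hz hg).prod_fiberwise fun m =>
    (summable_thetaConv hQ hQ0 hz hg m).hasSum.mul_left (z ^ m)

theorem thetaConv_recurrence (hQ : OrdGE 1 Q) (hQ0 : Q ≠ 0) (hz : z ≠ 0) {g : ℤ → K}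
    (hg : Summable fun k => z ^ k * g k) (x : K) (m : ℤ) :
    thetaConv Q g (m + 1) + x * Q ^ m * thetaConv Q g m =
      -∑' k : ℤ, (-1) ^ (m - k) * Q ^ tri (m - k) * ((1 - x * Q ^ k) * g k) := by
  have hs := summable_thetaConv hQ hQ0 hz hg
  rw [thetaConv, thetaConv, ← tsum_mul_left, ← (hs _).tsum_add ((hs m).mul_left _), ← tsum_neg]
  refine tsum_congr fun k => ?_
  rw [show m + 1 - k = m - k + 1 by ring, add_sub_cancel_right, tri_sub_one,
    zpow_add_one₀ (neg_ne_zero.2 one_ne_zero), zpow_sub₀ hQ0, zpow_sub₀ hQ0]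
  have := zpow_ne_zero k hQ0
  have := zpow_ne_zero m hQ0
  field_simp
  ring

theorem hasSum_neg_one_zpow_mul_tri (hQ : OrdGE 1 Q) (hQ0 : Q ≠ 0) :
    HasSum (fun j : ℤ => (-1) ^ j * Q ^ tri j) 0 := by
  rw [← theta_base hQ hQ0, theta]
  convert (summable_theta hQ hQ0 Q).hasSum using 2 with j
  rw [tri_sub_one, zpow_sub₀ hQ0, mul_assoc, div_mul_cancel₀ _ (zpow_ne_zero j hQ0)]

/-- Both sides have the same expansion in powers of `z`: the coefficients of the left-hand side
satisfy a first order recurrence, homogeneous since `theta Q Q = 0`. -/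
theorem theta_mul_kroneckerSum (hx : InAnnulus Q x) (hz : InAnnulus Q z) :
    theta Q z * kroneckerSum Q x z = theta Q (z * x) * appellLerch 1 Q x 1 := by
  have hQ := hx.ordGE_base
  have hQ0 := hx.base_ne_zero
  have hs := hx.summable_kroneckerSum hz
  have hrec (m : ℤ) : thetaConv Q (fun k => (1 - x * Q ^ k)⁻¹) (m + 1) +
      x * Q ^ m * thetaConv Q (fun k => (1 - x * Q ^ k)⁻¹) m = 0 := by
    rw [thetaConv_recurrence hQ hQ0 hz.ne_zero hs, neg_eq_zero]
    simp only [mul_inv_cancel₀ (hx.one_sub_mul_zpow_ne_zero _), mul_one]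
    exact ((Equiv.subLeft m).hasSum_iff.2 (hasSum_neg_one_zpow_mul_tri hQ hQ0)).tsum_eq
  have hzero : thetaConv Q (fun k => (1 - x * Q ^ k)⁻¹) 0 = appellLerch 1 Q x 1 := by
    simp only [thetaConv_zero, appellLerch, Nat.cast_one, one_mul, one_zpow, mul_one]
  rw [kroneckerSum, ← (hasSum_thetaConv hQ hQ0 hz.ne_zero hs).tsum_eq, theta, ← tsum_mul_right]
  refine tsum_congr fun m => ?_
  rw [eq_of_homogeneous_recurrence hQ0 hx.ne_zero hrec m, hzero, mul_zpow]
  ring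

end Convolution

section AppellDissection

variable {K : Type*} [Field K] [Valued K ℤᵐ⁰] [CompleteSpace K] {Q x : K}

/-- Expand `1 / (1 - a) = (1 + a + ⋯ + a ^ (m - 1)) / (1 - a ^ m)` in every term. -/
theorem appellLerch_eq_sum (hx : InAnnulus Q x) (z : K) {m : ℕ} (hm : 0 < m) :
    appellLerch m Q x z =
      ∑ i ∈ Finset.range m, x ^ i * appellLerch 1 (Q ^ m) (x ^ m) (z * Q ^ i) := by
  have hs (i : ℕ) := ((hx.pow hm).summable_appellLerch (z * Q ^ i) one_pos).mul_left (x ^ i)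
  simp only [appellLerch, ← tsum_mul_left]
  rw [← Summable.tsum_finsetSum fun i _ => hs i]
  refine tsum_congr fun k => ?_
  have ha := hx.one_sub_mul_zpow_ne_zero k
  have ham := (hx.pow hm).one_sub_mul_zpow_ne_zero k
  have hpow (i : ℕ) : (Q ^ i) ^ k = (Q ^ k) ^ i := by
    rw [← zpow_natCast, ← zpow_natCast, zpow_comm]
  have hgeom : (1 - x * Q ^ k)⁻¹ =
      (∑ i ∈ Finset.range m, (x * Q ^ k) ^ i) * (1 - x ^ m * (Q ^ m) ^ k)⁻¹ := by
    rw [eq_mul_inv_iff_mul_eq₀ ham, inv_mul_eq_iff_eq_mul₀ ha, mul_neg_geom_sum, hpow, mul_pow]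
  rw [hgeom, Finset.sum_mul, Finset.mul_sum]
  refine Finset.sum_congr rfl fun i _ => ?_
  rw [mul_zpow, hpow i, mul_pow, Nat.cast_one, one_mul, zpow_mul, zpow_natCast]
  ring

end AppellDissection

section KroneckerProduct

variable {K : Type*} [Field K] [Valued K ℤᵐ⁰] {Q x y z : K}

theorem InAnnulus.tendsto_inv_one_sub_atTop (hx : InAnnulus Q x) :
    Tendsto (fun n : ℕ => (1 - x * Q ^ (n : ℤ))⁻¹) atTop (𝓝 1) := by
  refine tendsto_sub_nhds_zero_iff.1
    (tendsto_zero_of_ordGE (e := fun n : ℕ => (n : ℤ)) tendsto_natCast_atTop_atTop fun n => ?_)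
  have heq : (1 - x * Q ^ (n : ℤ))⁻¹ - 1 = Q ^ n * (x * (1 - x * Q ^ (n : ℤ))⁻¹) := by
    have := hx.one_sub_mul_zpow_ne_zero n
    rw [zpow_natCast] at *
    field_simp
    ring
  rw [heq]
  exact (hx.ordGE_base.natCast_pow n).mul_right (hx.ordGE_mul_inv_one_sub n)

theorem InAnnulus.tendsto_inv_one_sub_neg_atTop (hx : InAnnulus Q x) :
    Tendsto (fun n : ℕ => (1 - x * Q ^ (-(n : ℤ)))⁻¹) atTop (𝓝 0) := by
  have h : Tendsto (fun n : ℕ => x * (1 - x * Q ^ (-(n : ℤ)))⁻¹) atTop (𝓝 0) := by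
    refine tendsto_zero_of_ordGE (e := fun n : ℕ => (n : ℤ)) tendsto_natCast_atTop_atTop fun n => ?_
    rcases n.eq_zero_or_pos with rfl | hn
    · exact hx.ordGE_mul_inv_one_sub _
    · simpa using hx.ordGE_mul_inv_one_sub_of_neg (k := -n) (by omega)
  simpa only [inv_mul_cancel_left₀ hx.ne_zero, mul_zero] using h.const_mul x⁻¹

theorem InAnnulus.inv_one_sub_mul_inv_one_sub (hx : InAnnulus Q x) (hy : InAnnulus Q y)
    (hxy : InAnnulus Q (x * y)) (m k : ℤ) :
    (1 - x * Q ^ (m - k))⁻¹ * (1 - y * Q ^ k)⁻¹ =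
      (1 - x * y * Q ^ m)⁻¹ * ((1 - x * Q ^ (m - k))⁻¹ + (1 - y * Q ^ k)⁻¹ - 1) := by
  have h1 := hx.one_sub_mul_zpow_ne_zero (m - k)
  have h2 := hy.one_sub_mul_zpow_ne_zero k
  have h3 := hxy.one_sub_mul_zpow_ne_zero m
  have hm : x * y * Q ^ m = x * Q ^ (m - k) * (y * Q ^ k) := by
    rw [mul_mul_mul_comm, ← zpow_add₀ hx.base_ne_zero, sub_add_cancel]
  rw [hm] at h3 ⊢
  generalize x * Q ^ (m - k) = a at *
  generalize y * Q ^ k = b at *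
  field_simp
  ring

variable [CompleteSpace K]

theorem InAnnulus.hasSum_kroneckerSum_mul (hx : InAnnulus Q x) (hy : InAnnulus Q y)
    (hz : InAnnulus Q z) :
    HasSum (fun p : ℤ × ℤ => z ^ p.1 * ((1 - x * Q ^ (p.1 - p.2))⁻¹ * (1 - y * Q ^ p.2)⁻¹))
      (kroneckerSum Q x z * kroneckerSum Q y z) := by
  rw [kroneckerSum, kroneckerSum]
  convert hasSum_mul_shear (hx.summable_kroneckerSum hz).hasSum (hy.summable_kroneckerSum hz).hasSum
    using 2 with p
  rw [zpow_sub₀ hz.ne_zero]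
  have := zpow_ne_zero p.2 hz.ne_zero
  field_simp

/-- The `m`-th coefficient of the product of the two Kronecker series with parameters `x` and `y`
is `kroneckerProdCoeff Q x y m / (1 - x * y * Q ^ m)`. -/
noncomputable def kroneckerProdCoeff (Q x y : K) (m : ℤ) : K :=
  ∑' k : ℤ, ((1 - x * Q ^ (m - k))⁻¹ + (1 - y * Q ^ k)⁻¹ - 1)

theorem InAnnulus.summable_kroneckerProdCoeff (hx : InAnnulus Q x) (hy : InAnnulus Q y)
    (hxy : InAnnulus Q (x * y)) (m : ℤ) :
    Summable fun k : ℤ => (1 - x * Q ^ (m - k))⁻¹ + (1 - y * Q ^ k)⁻¹ - 1 := by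
  have h := ((hx.hasSum_kroneckerSum_mul hy hx).summable.prod_factor m).mul_left
    ((1 - x * y * Q ^ m) * (x ^ m)⁻¹)
  refine h.congr fun k => ?_
  have := zpow_ne_zero m hx.ne_zero
  rw [mul_assoc, inv_mul_cancel_left₀ this, hx.inv_one_sub_mul_inv_one_sub hy hxy,
    mul_inv_cancel_left₀ (hxy.one_sub_mul_zpow_ne_zero m)]

/-- The difference of the two sides is a telescoping series. -/
theorem InAnnulus.kroneckerProdCoeff_add_one (hx : InAnnulus Q x) (hy : InAnnulus Q y)
    (hxy : InAnnulus Q (x * y)) (m : ℤ) :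
    kroneckerProdCoeff Q x y (m + 1) = kroneckerProdCoeff Q x y m + 1 := by
  have hs := hx.summable_kroneckerProdCoeff hy hxy
  let u : ℤ → K := fun k => (1 - x * Q ^ k)⁻¹
  have hdiff : Summable fun k => u (k + 1) - u k := by
    rw [← (Equiv.subLeft m).summable_iff]
    refine ((hs (m + 1)).sub (hs m)).congr fun k => ?_
    rw [Function.comp_apply, Equiv.subLeft_apply, show m - k + 1 = m + 1 - k by ring]
    ring
  have hpart (n : ℕ) : ∑ r ∈ Finset.range n,
      (u (r + 1) - u r + (u (-(r + 1) + 1) - u (-(r + 1)))) = u n - u (-n) := by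
    induction n with
    | zero => simp
    | succ n ih =>
      rw [Finset.sum_range_succ, ih, neg_add_rev, neg_add_cancel_comm, Nat.cast_add_one,
        neg_add_rev]
      ring
  have htele : ∑' k, (u (k + 1) - u k) = 1 := by
    refine tendsto_nhds_unique hdiff.hasSum.nat_add_neg_add_one.tendsto_sum_nat ?_
    simp only [hpart]
    simpa only [sub_zero] using hx.tendsto_inv_one_sub_atTop.sub hx.tendsto_inv_one_sub_neg_atTop
  rw [← sub_eq_iff_eq_add', ← htele, kroneckerProdCoeff, kroneckerProdCoeff,
    ← (hs _).tsum_sub (hs m), ← (Equiv.subLeft m).tsum_eq]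
  refine tsum_congr fun k => ?_
  rw [Equiv.subLeft_apply, show m + 1 - (m - k) = k + 1 by ring, sub_sub_cancel]
  ring

theorem InAnnulus.kroneckerProdCoeff_eq (hx : InAnnulus Q x) (hy : InAnnulus Q y)
    (hxy : InAnnulus Q (x * y)) (m : ℤ) :
    kroneckerProdCoeff Q x y m = kroneckerProdCoeff Q x y 0 + m := by
  have hstep := hx.kroneckerProdCoeff_add_one hy hxy
  induction m using Int.induction_on with
  | zero => simp
  | succ i ih => rw [hstep, ih]; push_cast; ring
  | pred i ih =>
    have h := hstep (-i - 1)
    rw [sub_add_cancel, ih] at h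
    push_cast at h ⊢
    linear_combination -h

theorem InAnnulus.kroneckerSum_mul_kroneckerSum (hx : InAnnulus Q x) (hy : InAnnulus Q y)
    (hxy : InAnnulus Q (x * y)) (hz : InAnnulus Q z) :
    kroneckerSum Q x z * kroneckerSum Q y z =
      ∑' m : ℤ, (kroneckerProdCoeff Q x y 0 + m) * (z ^ m * (1 - x * y * Q ^ m)⁻¹) := by
  refine ((hx.hasSum_kroneckerSum_mul hy hz).prod_fiberwise fun m => ?_).tsum_eq.symm
  have h := (hx.summable_kroneckerProdCoeff hy hxy m).hasSum.mul_left
    (z ^ m * (1 - x * y * Q ^ m)⁻¹)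
  rw [← kroneckerProdCoeff, hx.kroneckerProdCoeff_eq hy hxy, mul_comm _ (_ + _)] at h
  refine h.congr_fun fun k => ?_
  rw [hx.inv_one_sub_mul_inv_one_sub hy hxy]
  exact (mul_assoc _ _ _).symm

/-- The series `∑ m, (n * m + c) * q ^ m / (1 - q ^ (n * m + c))`. -/
noncomputable def lambertSum (n c : ℕ) (q : K) : K :=
  ∑' m : ℤ, (n * m + c) * (q ^ m * (1 - q ^ c * (q ^ n) ^ m)⁻¹)

theorem theta_pow_three_self {q : K} (hq : OrdGE 1 q) (hq0 : q ≠ 0) :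
    theta (q ^ 3) q = euler q := by
  have hdiv : q ^ 3 / q = q ^ 2 := by field_simp
  rw [← theta_base_div (pow_ne_zero 3 hq0), hdiv, theta_pow_three_sq hq hq0]

theorem kroneckerSum_pow_three_self {q : K} (hq : OrdGE 1 q) (hq0 : q ≠ 0) :
    kroneckerSum (q ^ 3) q q = appellLerch 1 (q ^ 3) q 1 := by
  have hA := inAnnulus_pow_three hq hq0
  refine mul_left_cancel₀ (euler_ne_zero hq) ?_
  rw [← theta_pow_three_self hq hq0, theta_mul_kroneckerSum hA hA, ← sq, theta_pow_three_sq hq hq0,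
    theta_pow_three_self hq hq0]

theorem kroneckerSum_pow_three_sq {q : K} (hq : OrdGE 1 q) (hq0 : q ≠ 0) :
    kroneckerSum (q ^ 3) (q ^ 2) q = 0 := by
  have h := theta_mul_kroneckerSum (inAnnulus_pow_three_sq hq hq0) (inAnnulus_pow_three hq hq0)
  rw [show q * q ^ 2 = q ^ 3 by ring, theta_base (hq.pow_of_pos three_pos) (pow_ne_zero 3 hq0),
    zero_mul, theta_pow_three_self hq hq0] at h
  exact (mul_eq_zero.1 h).resolve_left (euler_ne_zero hq)

theorem lambertSum_three_two {q : K} (hq : OrdGE 1 q) (hq0 : q ≠ 0) :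
    lambertSum 3 2 q = 3 * appellLerch 1 (q ^ 3) q 1 ^ 2 := by
  have hA := inAnnulus_pow_three hq hq0
  have hA2 := inAnnulus_pow_three_sq hq hq0
  have hk := hA2.summable_kroneckerSum hA
  have hk0 := kroneckerSum_pow_three_sq hq hq0
  have hprod := hA.kroneckerSum_mul_kroneckerSum hA (sq q ▸ hA2) hA
  set c := kroneckerProdCoeff (q ^ 3) q q 0
  have hkm : Summable fun m : ℤ => (m : K) * (q ^ m * (1 - q ^ 2 * (q ^ 3) ^ m)⁻¹) :=
    (summable_mul_ordGE hk ordGE_intCast).congr fun m => mul_comm _ _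
  rw [kroneckerSum_pow_three_self hq hq0, ← sq, ← sq] at hprod
  simp only [add_mul] at hprod
  rw [(hk.mul_left c).tsum_add hkm, tsum_mul_left, ← kroneckerSum, hk0, mul_zero, zero_add] at hprod
  have hsplit (m : ℤ) : ((3 : ℕ) * m + (2 : ℕ)) * (q ^ m * (1 - q ^ 2 * (q ^ 3) ^ m)⁻¹) =
      3 * (m * (q ^ m * (1 - q ^ 2 * (q ^ 3) ^ m)⁻¹)) +
        2 * (q ^ m * (1 - q ^ 2 * (q ^ 3) ^ m)⁻¹) := by
    push_cast
    ring
  rw [hprod, lambertSum, tsum_congr hsplit, (hkm.mul_left 3).tsum_add (hk.mul_left 2),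
    tsum_mul_left, tsum_mul_left, ← kroneckerSum, hk0, mul_zero, add_zero]

end KroneckerProduct

section Quadrant

/-- The sign of the quadrant of `(r, k)` in the expansion
`1 / ((1 - a) (1 - b)) = ∑ a ^ r b ^ k` of either sign: `1` if both arguments are nonnegative, `-1`
if both are negative, and `0` otherwise. -/
def quadrantSign (r k : ℤ) : ℤ :=
  if 0 ≤ r ∧ 0 ≤ k then 1 else if r < 0 ∧ k < 0 then -1 else 0

theorem quadrantSign_sub (r k : ℤ) :
    quadrantSign r k - quadrantSign (r - 1) k = if r = 0 then 1 else 0 := by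
  unfold quadrantSign
  grind

theorem quadrantSign_neg_one_sub (r : ℤ) : quadrantSign r (-1 - r) = 0 := by
  unfold quadrantSign
  grind

/-- The change of variables `(m, r) ↦ (r, m - 1 - r)`. -/
def antidiagonalEquiv : ℤ × ℤ ≃ ℤ × ℤ where
  toFun p := (p.2, p.1 - 1 - p.2)
  invFun p := (p.1 + p.2 + 1, p.1)
  left_inv p := by ext <;> simp
  right_inv p := by ext <;> simp

end Quadrant

section AppellCoeff

variable {K : Type*} [Field K] [Valued K ℤᵐ⁰] {Q z t : K}

/-- The coefficient of `z ^ m` in the expansion of `z * appellLerch 1 Q z z`. -/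
noncomputable def appellCoeff (Q : K) (m : ℤ) : K :=
  ∑' r : ℤ, quadrantSign r (m - 1 - r) * ((-1) ^ r * Q ^ (tri r + r * (m - 1 - r)))

theorem appellCoeff_zero (Q : K) : appellCoeff Q 0 = 0 := by
  simp only [appellCoeff, zero_sub, quadrantSign_neg_one_sub, Int.cast_zero, zero_mul, tsum_zero]

theorem InAnnulus.ordGE_quadrantSign_mul (hz : InAnnulus Q z) (r k : ℤ) :
    OrdGE (|r| + |k| - 1)
      (quadrantSign r k * ((-1) ^ r * Q ^ (tri r + r * k) * z ^ (r + k + 1))) := by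
  have hr := tri_nonneg r
  unfold quadrantSign
  split_ifs with h h'
  · have hrk := mul_nonneg h.1 h.2
    rw [abs_of_nonneg h.1, abs_of_nonneg h.2]
    refine (ordGE_intCast 1).mul_left (OrdGE.mono (D := 0 + (tri r + r * k) + (r + k + 1))
      (((ordGE_neg_one_zpow r).mul (hz.ordGE_base.zpow (by positivity))).mul
        (hz.ordGE_one.zpow (by omega))) ?_)
    linarith
  · have hrk := mul_nonneg (show 0 ≤ -1 - r by omega) (show 0 ≤ -1 - k by omega)
    have heq : Q ^ (tri r + r * k) * z ^ (r + k + 1) =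
        Q ^ (tri r + (-1 - r) * (-1 - k)) * (Q / z) ^ (-1 - r - k) := by
      rw [show -1 - r - k = -(r + k + 1) by ring, div_zpow, zpow_neg, zpow_neg,
        show tri r + (-1 - r) * (-1 - k) = tri r + r * k + (r + k + 1) by ring,
        zpow_add₀ hz.base_ne_zero _ (r + k + 1)]
      have := zpow_ne_zero (r + k + 1) hz.base_ne_zero
      have := zpow_ne_zero (r + k + 1) hz.ne_zero
      field_simp
    rw [abs_of_neg h'.1, abs_of_neg h'.2, mul_assoc, heq]
    refine (ordGE_intCast (-1)).mul_left ((ordGE_neg_one_zpow r).mul_left (OrdGE.mono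
      ((hz.ordGE_base.zpow (add_nonneg hr hrk)).mul (hz.ordGE_one_div.zpow (by omega))) ?_))
    linarith
  · rw [Int.cast_zero, zero_mul]
    exact ordGE_zero _

variable [CompleteSpace K]

theorem hasSum_geometric_of_ordGE (ht : OrdGE 1 t) : HasSum (fun n : ℕ => t ^ n) (1 - t)⁻¹ := by
  have hs : Summable fun n : ℕ => t ^ n := summable_of_ordGE tendsto_natCast_cofinite ht.natCast_pow
  rw [← eq_inv_of_mul_eq_one_left hs.tsum_pow_mul_one_sub]
  exact hs.hasSum

theorem InAnnulus.hasSum_quadrantSign_mul_zpow (hz : InAnnulus Q z) (r : ℤ) :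
    HasSum (fun k : ℤ => quadrantSign r k * (z * Q ^ r) ^ k) (1 - z * Q ^ r)⁻¹ := by
  rcases le_or_gt 0 r with hr | hr
  · have hgeom := hasSum_geometric_of_ordGE (hz.ordGE_one.mul_zpow hz.ordGE_base hr)
    rw [← add_zero (1 - z * Q ^ r)⁻¹]
    refine HasSum.of_nat_of_neg_add_one (hgeom.congr_fun fun n => ?_)
      (hasSum_zero.congr_fun fun n => ?_)
    · have hsign : quadrantSign r n = 1 := by grind [quadrantSign]
      rw [hsign, Int.cast_one, one_mul, zpow_natCast]
    · have hsign : quadrantSign r (-(n + 1)) = 0 := by grind [quadrantSign]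
      rw [hsign, Int.cast_zero, zero_mul]
  · obtain ⟨s, rfl⟩ : ∃ s, r = -1 - s := ⟨-1 - r, by ring⟩
    have hgeom := (hasSum_geometric_of_ordGE
      (hz.ordGE_one_div.mul_zpow hz.ordGE_base (n := s) (by omega))).mul_left (-(Q / z * Q ^ s))
    rw [neg_mul, ← inv_one_sub_mul_zpow_neg_one_sub hz.base_ne_zero hz.ne_zero] at hgeom
    rw [← zero_add (1 - z * Q ^ (-1 - s))⁻¹]
    refine HasSum.of_nat_of_neg_add_one (hasSum_zero.congr_fun fun n => ?_)
      (hgeom.congr_fun fun n => ?_)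
    · have hsign : quadrantSign (-1 - s) n = 0 := by grind [quadrantSign]
      rw [hsign, Int.cast_zero, zero_mul]
    · have hsign : quadrantSign (-1 - s) (-(n + 1)) = -1 := by grind [quadrantSign]
      have hinv : (z * Q ^ (-1 - s))⁻¹ = Q / z * Q ^ s := by
        rw [mul_inv, ← zpow_neg, neg_sub, sub_neg_eq_add, zpow_add_one₀ hz.base_ne_zero]
        ring
      rw [hsign, zpow_neg, ← inv_zpow, hinv, ← Nat.cast_add_one, zpow_natCast, pow_succ']
      push_cast
      ring

theorem InAnnulus.hasSum_quadrantSign_mul (hz : InAnnulus Q z) :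
    HasSum (fun p : ℤ × ℤ =>
      quadrantSign p.1 p.2 * ((-1) ^ p.1 * Q ^ (tri p.1 + p.1 * p.2) * z ^ (p.1 + p.2 + 1)))
      (z * appellLerch 1 Q z z) := by
  have hs : Summable fun p : ℤ × ℤ =>
      quadrantSign p.1 p.2 * ((-1) ^ p.1 * Q ^ (tri p.1 + p.1 * p.2) * z ^ (p.1 + p.2 + 1)) :=
    summable_of_ordGE (tendsto_atTop_add_const_right _ (-1) (tendsto_add_cofinite_of_nonneg
      tendsto_abs_cofinite tendsto_abs_cofinite abs_nonneg abs_nonneg))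
      fun p => hz.ordGE_quadrantSign_mul p.1 p.2
  have hfib := hs.hasSum.prod_fiberwise fun r =>
    ((hz.hasSum_quadrantSign_mul_zpow r).mul_left
      (z * ((-1) ^ r * Q ^ tri r * z ^ r))).congr_fun fun k => by
        rw [zpow_add₀ hz.base_ne_zero, zpow_add_one₀ hz.ne_zero, zpow_add₀ hz.ne_zero, mul_zpow,
          zpow_mul]
        ring
  convert hs.hasSum using 1
  rw [← hfib.tsum_eq, appellLerch, ← tsum_mul_left]
  simp only [Nat.cast_one, one_mul, mul_assoc]

theorem InAnnulus.hasSum_antidiagonal (hz : InAnnulus Q z) :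
    HasSum (fun p : ℤ × ℤ => z ^ p.1 * (quadrantSign p.2 (p.1 - 1 - p.2) *
      ((-1) ^ p.2 * Q ^ (tri p.2 + p.2 * (p.1 - 1 - p.2))))) (z * appellLerch 1 Q z z) := by
  refine (antidiagonalEquiv.hasSum_iff.2 hz.hasSum_quadrantSign_mul).congr_fun fun p => ?_
  simp only [Function.comp_apply, antidiagonalEquiv, Equiv.coe_fn_mk,
    show p.2 + (p.1 - 1 - p.2) + 1 = p.1 by ring]
  ring

theorem InAnnulus.summable_appellCoeff (hz : InAnnulus Q z) (m : ℤ) :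
    Summable fun r : ℤ => (quadrantSign r (m - 1 - r) : K) *
      ((-1) ^ r * Q ^ (tri r + r * (m - 1 - r))) := by
  have h := (hz.hasSum_antidiagonal.summable.prod_factor m).mul_left (z ^ m)⁻¹
  simpa only [inv_mul_cancel_left₀ (zpow_ne_zero m hz.ne_zero)] using h

theorem InAnnulus.hasSum_appellCoeff (hz : InAnnulus Q z) :
    HasSum (fun m => z ^ m * appellCoeff Q m) (z * appellLerch 1 Q z z) :=
  hz.hasSum_antidiagonal.prod_fiberwise fun m =>
    (hz.summable_appellCoeff m).hasSum.mul_left (z ^ m)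

/-- Shifting `r` in the second sum makes all terms cancel, except the one with `r = 0`. -/
theorem InAnnulus.appellCoeff_recurrence (hz : InAnnulus Q z) (m : ℤ) :
    appellCoeff Q (m + 1) + Q ^ m * appellCoeff Q m = 1 := by
  have h1 := (hz.summable_appellCoeff (m + 1)).hasSum
  have h2 := ((Equiv.subRight 1).hasSum_iff.2 (hz.summable_appellCoeff m).hasSum).mul_left (Q ^ m)
  refine (h1.add h2).unique ((hasSum_ite_eq 0 1).congr_fun fun r => ?_)
  have hQ : Q ^ m * Q ^ (tri (r - 1) + (r - 1) * (m - r)) = Q ^ (tri r + r * (m - r)) := by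
    rw [← zpow_add₀ hz.base_ne_zero, tri_sub_one]
    congr 1
    ring
  have hsign : (-1 : K) ^ (r - 1) = -(-1) ^ r := by
    rw [zpow_sub_one₀ (neg_ne_zero.2 one_ne_zero), inv_neg_one, mul_neg_one]
  have hjump : (quadrantSign r (m - r) : K) - quadrantSign (r - 1) (m - r) =
      if r = 0 then 1 else 0 := by
    rw [← Int.cast_sub, quadrantSign_sub]
    split_ifs <;> simp
  have hone : (if r = 0 then 1 else 0 : K) =
      (if r = 0 then 1 else 0) * ((-1) ^ r * Q ^ (tri r + r * (m - r))) := by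
    split_ifs with hr
    · simp [hr, tri_zero]
    · rw [zero_mul]
  rw [Function.comp_apply, Equiv.subRight_apply, show m + 1 - 1 - r = m - r by ring,
    show m - 1 - (r - 1) = m - r by ring, hsign, hone, ← hjump, ← hQ]
  ring

end AppellCoeff

section LambertAppell

theorem inv_one_sub_zpow {F : Type*} [Field F] {Q : F} (hQ0 : Q ≠ 0) (k : ℤ) :
    (1 - Q ^ k)⁻¹ = -(Q ^ (-k) * (1 - Q ^ (-k))⁻¹) := by
  have h := inv_one_sub_mul_zpow_neg_one_sub hQ0 hQ0 (-k)
  rwa [← zpow_one_add₀ hQ0, show 1 + (-1 - -k) = k by ring, div_self hQ0, one_mul] at h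

variable {K : Type*} [Field K] [Valued K ℤᵐ⁰] {Q z : K}

/-- The series `∑ k, k * z ^ k / (1 - Q ^ k)`. Its term at `k = 0` vanishes. -/
noncomputable def weightedKroneckerSum (Q z : K) : K := ∑' k : ℤ, z ^ k * (k * (1 - Q ^ k)⁻¹)

/-- The series `∑ k, (-1) ^ k * Q ^ (k * (k + 1) / 2) * k / (1 - Q ^ k)`. Its term at `k = 0`
vanishes. -/
noncomputable def weightedAppellSum (Q : K) : K :=
  ∑' k : ℤ, (-1) ^ k * Q ^ tri k * (k * (1 - Q ^ k)⁻¹)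

theorem ordGE_inv_one_sub_zpow (hQ : OrdGE 1 Q) (hQ0 : Q ≠ 0) (k : ℤ) :
    OrdGE 0 (1 - Q ^ k)⁻¹ := by
  rcases lt_trichotomy k 0 with hk | rfl | hk
  · have hk' : OrdGE 1 (Q ^ (-k)) := hQ.zpow_of_pos (by omega)
    rw [inv_one_sub_zpow hQ0]
    exact ((hk'.mono zero_le_one).mul_left hk'.inv_one_sub).neg
  · simpa using ordGE_zero 0
  · exact (hQ.zpow_of_pos hk).inv_one_sub

theorem InAnnulus.ordGE_weightedKroneckerSum (hz : InAnnulus Q z) (k : ℤ) :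
    OrdGE |k| (z ^ k * (k * (1 - Q ^ k)⁻¹)) := by
  have hQ := hz.ordGE_base
  rcases lt_or_ge k 0 with hk | hk
  · have heq : z ^ k * (k * (1 - Q ^ k)⁻¹) = k * ((Q / z) ^ (-k) * -(1 - Q ^ (-k))⁻¹) := by
      rw [inv_one_sub_zpow hz.base_ne_zero, div_zpow, zpow_neg z]
      field_simp
    rw [heq, abs_of_neg hk]
    exact (ordGE_intCast k).mul_left ((hz.ordGE_one_div.zpow (by omega)).mul_right
      (hQ.zpow_of_pos (by omega)).inv_one_sub.neg)
  · rw [abs_of_nonneg hk]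
    exact (hz.ordGE_one.zpow hk).mul_right
      ((ordGE_intCast k).mul_left (ordGE_inv_one_sub_zpow hQ hz.base_ne_zero k))

variable [CompleteSpace K]

theorem InAnnulus.summable_weightedKroneckerSum (hz : InAnnulus Q z) :
    Summable fun k : ℤ => z ^ k * (k * (1 - Q ^ k)⁻¹) :=
  summable_of_ordGE tendsto_abs_cofinite hz.ordGE_weightedKroneckerSum

theorem InAnnulus.thetaConv_weighted_recurrence (hz : InAnnulus Q z) (m : ℤ) :
    thetaConv Q (fun k => k * (1 - Q ^ k)⁻¹) (m + 1) +
      Q ^ m * thetaConv Q (fun k => k * (1 - Q ^ k)⁻¹) m = euler Q ^ 3 := by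
  have hQ := hz.ordGE_base
  have hQ0 := hz.base_ne_zero
  have h := thetaConv_recurrence hQ hQ0 hz.ne_zero hz.summable_weightedKroneckerSum 1 m
  have hcancel (k : ℤ) : (1 - Q ^ k) * (k * (1 - Q ^ k)⁻¹) = k := by
    rcases eq_or_ne k 0 with rfl | hk
    · simp
    · rw [mul_left_comm, mul_inv_cancel₀ (sub_ne_zero.2 (hQ.zpow_ne_one hk).symm), mul_one]
  simp only [one_mul, hcancel] at h
  have hθ := hasSum_neg_one_zpow_mul_tri hQ hQ0
  have hθ' : HasSum (fun j : ℤ => (-1) ^ j * Q ^ tri j * (j : K)) (euler Q ^ 3) := by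
    rw [← tsum_int_mul_tri hQ hQ0]
    exact (summable_mul_ordGE hθ.summable ordGE_intCast).hasSum
  rw [h, ← tsum_neg]
  refine ((Equiv.subLeft m).tsum_eq _).symm.trans ?_
  rw [← sub_zero (euler Q ^ 3), ← mul_zero (m : K)]
  refine ((hθ'.sub (hθ.mul_left (m : K))).congr_fun fun k => ?_).tsum_eq
  rw [Equiv.subLeft_apply, sub_sub_cancel]
  push_cast
  ring

/-- Both sides have the same expansion in powers of `z`: the coefficients of
`theta Q z * weightedKroneckerSum Q z` and of `euler Q ^ 3 * z * appellLerch 1 Q z z` satisfy the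
same recurrence, and the solutions of the homogeneous one are the coefficients of `theta Q z`. -/
theorem InAnnulus.euler_pow_three_mul_appellLerch (hz : InAnnulus Q z) :
    euler Q ^ 3 * (z * appellLerch 1 Q z z) =
      theta Q z * (weightedKroneckerSum Q z - weightedAppellSum Q) := by
  have hQ := hz.ordGE_base
  have hQ0 := hz.base_ne_zero
  let d (m : ℤ) : K := thetaConv Q (fun k => k * (1 - Q ^ k)⁻¹) m - euler Q ^ 3 * appellCoeff Q m
  have hd0 : d 0 = weightedAppellSum Q := by
    simp only [d, appellCoeff_zero, mul_zero, sub_zero, thetaConv_zero, weightedAppellSum]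
  have hrec (m : ℤ) : d (m + 1) + 1 * Q ^ m * d m = 0 := by
    linear_combination hz.thetaConv_weighted_recurrence m -
      euler Q ^ 3 * hz.appellCoeff_recurrence m
  have hsum := (hasSum_thetaConv hQ hQ0 hz.ne_zero hz.summable_weightedKroneckerSum).sub
    (hz.hasSum_appellCoeff.mul_left (euler Q ^ 3))
  have htheta := (summable_theta hQ hQ0 z).hasSum.mul_right (d 0)
  rw [← theta, hd0] at htheta
  have heq := hsum.unique (htheta.congr_fun fun m => ?_)
  · rw [← weightedKroneckerSum] at heq
    linear_combination -heq
  · have hm := eq_of_homogeneous_recurrence hQ0 one_ne_zero hrec m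
    rw [one_zpow, hd0] at hm
    linear_combination z ^ m * hm

end LambertAppell

section Trisection

theorem tsum_int_eq_sum_tsum {α : Type*} [AddCommGroup α] [UniformSpace α] [IsUniformAddGroup α]
    [CompleteSpace α] [T2Space α] {f : ℤ → α} (hf : Summable f) (n : ℕ) [NeZero n] :
    ∑' k, f k = ∑ c : Fin n, ∑' m, f (m * n + c) := by
  have h := (((Equiv.prodComm _ _).trans (Int.divModEquiv n).symm).hasSum_iff.2 hf.hasSum)
  refine (h.prod_fiberwise fun c => (h.summable.prod_factor c).hasSum).unique (hasSum_fintype _)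

variable {K : Type*} [Field K] [Valued K ℤᵐ⁰] [CompleteSpace K] {q : K}

theorem weightedKroneckerSum_eq_sum {n : ℕ} [NeZero n] (hq : InAnnulus (q ^ n) q) :
    weightedKroneckerSum (q ^ n) q = ∑ c : Fin n, q ^ (c : ℕ) * lambertSum n c (q ^ n) := by
  rw [weightedKroneckerSum, tsum_int_eq_sum_tsum hq.summable_weightedKroneckerSum n]
  refine Finset.sum_congr rfl fun c _ => ?_
  rw [lambertSum, ← tsum_mul_left]
  refine tsum_congr fun m => ?_
  rw [zpow_add₀ hq.ne_zero, zpow_add₀ hq.base_ne_zero, mul_comm m, zpow_mul, zpow_mul,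
    zpow_natCast, zpow_natCast, zpow_natCast, zpow_natCast]
  push_cast
  ring

end Trisection

section LaurentSeries

open scoped LaurentSeries

variable {F : Type*} [Field F]

variable (F) in
/-- The variable of the field of Laurent series over `F`. -/
noncomputable def laurentX : F⸨X⸩ := HahnSeries.single 1 1

theorem laurentX_zpow (n : ℤ) : laurentX F ^ n = HahnSeries.single n 1 := by
  rw [laurentX, ← RatFunc.single_zpow]

theorem laurentX_ne_zero : laurentX F ≠ 0 := by
  rw [laurentX]; simp

theorem ordGE_laurentX : OrdGE 1 (laurentX F) := by
  rw [OrdGE, laurentX]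
  exact (LaurentSeries.valuation_single_zpow F 1).le

theorem ordGE_laurent_iff {D : ℤ} {f : F⸨X⸩} : OrdGE D f ↔ ∀ n < D, f.coeff n = 0 :=
  LaurentSeries.valuation_le_iff_coeff_lt_eq_zero F

theorem coeff_laurentX_pow_mul (i : ℕ) (n : ℤ) (f : F⸨X⸩) :
    (laurentX F ^ i * f).coeff n = f.coeff (n - i) := by
  have := HahnSeries.coeff_single_mul_add (r := (1 : F)) (x := f) (a := n - i) (b := i)
  rwa [← laurentX_zpow, sub_add_cancel, one_mul, zpow_natCast] at this

/-- Multiplication by `n` as an order embedding of the integers. -/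
noncomputable def natMulEmb (n : ℕ) [NeZero n] : ℤ ↪o ℤ :=
  OrderEmbedding.ofStrictMono (fun k => n * k) fun _ _ h =>
    mul_lt_mul_of_pos_left h (Int.natCast_pos.2 (NeZero.pos n))

/-- The endomorphism `q ↦ q ^ n` of the field of Laurent series. -/
noncomputable def laurentExpand (n : ℕ) [NeZero n] : F⸨X⸩ →+* F⸨X⸩ :=
  HahnSeries.embDomainRingHom (AddMonoidHom.mulLeft (n : ℤ)) (natMulEmb n).injective
    fun _ _ => (natMulEmb n).le_iff_le

variable (n : ℕ) [NeZero n]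

theorem coeff_laurentExpand_mul (f : F⸨X⸩) (k : ℤ) :
    (laurentExpand n f).coeff (n * k) = f.coeff k :=
  HahnSeries.embDomain_coeff (f := natMulEmb n)

theorem coeff_laurentExpand_of_not_dvd (f : F⸨X⸩) {k : ℤ} (h : ¬ (n : ℤ) ∣ k) :
    (laurentExpand n f).coeff k = 0 :=
  HahnSeries.embDomain_of_notMem_range (f := natMulEmb n) fun ⟨m, hm⟩ => h ⟨m, hm.symm⟩

theorem laurentExpand_laurentX : laurentExpand n (laurentX F) = laurentX F ^ n := by
  rw [← zpow_natCast, laurentX_zpow, ← mul_one (n : ℤ)]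
  exact HahnSeries.embDomain_single (f := natMulEmb n)

theorem continuous_laurentExpand : Continuous (laurentExpand n : F⸨X⸩ →+* F⸨X⸩) := by
  refine continuous_of_continuousAt_zero _ ?_
  rw [ContinuousAt, map_zero, tendsto_zero_iff_ordGE]
  intro D
  filter_upwards [eventually_nhds_zero_ordGE |D|] with f hf
  refine ordGE_laurent_iff.2 fun k hk => ?_
  by_cases hnk : (n : ℤ) ∣ k
  · obtain ⟨m, rfl⟩ := hnk
    rw [coeff_laurentExpand_mul]
    have hn : (1 : ℤ) ≤ n := Int.natCast_pos.2 (NeZero.pos n)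
    exact ordGE_laurent_iff.1 hf m (by nlinarith [le_abs_self D, abs_nonneg D])
  · exact coeff_laurentExpand_of_not_dvd n f hnk

variable {n} in
theorem eq_of_sum_laurentX_pow_mul_eq {a b : Fin n → F⸨X⸩}
    (h : ∑ i : Fin n, laurentX F ^ (i : ℕ) * laurentExpand n (a i) =
      ∑ i : Fin n, laurentX F ^ (i : ℕ) * laurentExpand n (b i)) : a = b := by
  have hcoeff (a : Fin n → F⸨X⸩) (j : Fin n) (k : ℤ) :
      (∑ i : Fin n, laurentX F ^ (i : ℕ) * laurentExpand n (a i)).coeff (n * k + j) =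
        (a j).coeff k := by
    rw [HahnSeries.coeff_sum, Finset.sum_eq_single j]
    · rw [coeff_laurentX_pow_mul, add_sub_cancel_right, coeff_laurentExpand_mul]
    · intro i _ hij
      rw [coeff_laurentX_pow_mul, coeff_laurentExpand_of_not_dvd]
      rw [add_sub_assoc, dvd_add_right (dvd_mul_right _ _)]
      intro hdvd
      have := Int.eq_zero_of_abs_lt_dvd hdvd (by rw [abs_lt]; omega)
      exact hij (Fin.ext (by omega))
    · simp
  ext j k
  rw [← hcoeff a, ← hcoeff b, h]

end LaurentSeries

section Map

variable {K L : Type*} [Field K] [Valued K ℤᵐ⁰] [CompleteSpace K] [Field L] [Valued L ℤᵐ⁰]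
  {φ : K →+* L} {Q q x : K}

theorem map_euler (hφ : Continuous φ) (hq : OrdGE 1 q) : φ (euler q) = euler (φ q) := by
  rw [euler, (multipliable_one_sub_pow_succ hq).map_tprod φ hφ]
  simp only [map_sub, map_one, map_pow, euler]

theorem InAnnulus.map_appellLerch (hφ : Continuous φ) (hx : InAnnulus Q x) (z : K) {ℓ : ℕ}
    (hℓ : 0 < ℓ) : φ (appellLerch ℓ Q x z) = appellLerch ℓ (φ Q) (φ x) (φ z) := by
  rw [appellLerch, (hx.summable_appellLerch z hℓ).map_tsum φ hφ]
  simp only [map_mul, map_zpow₀, map_neg, map_one, map_inv₀, map_sub, appellLerch]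

theorem map_weightedAppellSum (hφ : Continuous φ) (hQ : OrdGE 1 Q) (hQ0 : Q ≠ 0) :
    φ (weightedAppellSum Q) = weightedAppellSum (φ Q) := by
  have hs : Summable fun k : ℤ => (-1) ^ k * Q ^ tri k * (k * (1 - Q ^ k)⁻¹) := by
    refine summable_mul_ordGE ?_ fun k =>
      (ordGE_intCast k).mul_left (ordGE_inv_one_sub_zpow hQ hQ0 k)
    simpa using summable_zpow_mul_tri hQ 1 one_pos
  rw [weightedAppellSum, hs.map_tsum φ hφ]
  simp only [map_mul, map_zpow₀, map_neg, map_one, map_inv₀, map_sub, map_intCast,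
    weightedAppellSum]

theorem summable_lambertSum {n c : ℕ} (hq : OrdGE 1 q) (hq0 : q ≠ 0) (hn : 1 < n) (hc : c < n) :
    Summable fun m : ℤ => (n * m + c : K) * (q ^ m * (1 - q ^ c * (q ^ n) ^ m)⁻¹) := by
  have hA : InAnnulus (q ^ n) q := by simpa only [pow_one] using inAnnulus_pow_pow hq hq0 one_pos hn
  rcases c.eq_zero_or_pos with rfl | hc0
  · refine (hA.summable_weightedKroneckerSum.mul_left (n : K)).congr fun m => ?_
    push_cast
    ring
  · refine (summable_mul_ordGE ((inAnnulus_pow_pow hq hq0 hc0 hc).summable_kroneckerSum hA)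
      fun m => ordGE_intCast (n * m + c)).congr fun m => ?_
    push_cast
    ring

theorem map_lambertSum {n c : ℕ} (hφ : Continuous φ) (hq : OrdGE 1 q) (hq0 : q ≠ 0) (hn : 1 < n)
    (hc : c < n) : φ (lambertSum n c q) = lambertSum n c (φ q) := by
  rw [lambertSum, (summable_lambertSum hq hq0 hn hc).map_tsum φ hφ]
  simp only [map_mul, map_add, map_natCast, map_intCast, map_zpow₀, map_pow, map_one, map_inv₀,
    map_sub, lambertSum]

end Map

section IntegralSeries

open scoped LaurentSeries

/-- The embedding of the integral power series into the field of Laurent series over `ℚ`. -/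
noncomputable def toLaurent : ℤ⟦X⟧ →+* ℚ⸨X⸩ :=
  (HahnSeries.ofPowerSeries ℤ ℚ).comp (PowerSeries.map (Int.castRingHom ℚ))

theorem coeff_toLaurent_natCast (f : ℤ⟦X⟧) (k : ℕ) :
    (toLaurent f).coeff k = PowerSeries.coeff k f :=
  (HahnSeries.ofPowerSeries_apply_coeff _ k).trans (PowerSeries.coeff_map _ _ _)

theorem coeff_toLaurent_of_neg (f : ℤ⟦X⟧) {k : ℤ} (hk : k < 0) : (toLaurent f).coeff k = 0 := by
  have := PowerSeries.coeff_coe (PowerSeries.map (Int.castRingHom ℚ) f) k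
  rwa [if_pos hk] at this

theorem toLaurent_injective : Function.Injective toLaurent := fun f g h => by
  ext k
  have := congr_arg (HahnSeries.coeff · (k : ℤ)) h
  simpa only [coeff_toLaurent_natCast, Int.cast_inj] using this

theorem toLaurent_X : toLaurent PowerSeries.X = laurentX ℚ := by
  simp [toLaurent, laurentX]

theorem continuous_toLaurent : Continuous toLaurent := by
  refine continuous_of_continuousAt_zero toLaurent ?_
  rw [ContinuousAt, map_zero, tendsto_zero_iff_ordGE]
  intro D
  have hcoeff (k : ℕ) : ∀ᶠ f in 𝓝 (0 : ℤ⟦X⟧), PowerSeries.coeff k f = 0 := by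
    have := (PowerSeries.WithPiTopology.continuous_coeff ℤ k).tendsto 0
    rw [map_zero, nhds_discrete ℤ] at this
    exact this (Set.mem_singleton _)
  filter_upwards [(eventually_all_finset (Finset.range D.toNat)).2 fun k _ => hcoeff k] with f hf
  refine ordGE_laurent_iff.2 fun k hk => ?_
  rcases lt_or_ge k 0 with hk0 | hk0
  · exact coeff_toLaurent_of_neg f hk0
  · lift k to ℕ using hk0
    rw [coeff_toLaurent_natCast, hf k (Finset.mem_range.2 (by omega)), Int.cast_zero]

theorem laurentExpand_toLaurent (n : ℕ) [NeZero n] (f : ℤ⟦X⟧) :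
    laurentExpand n (toLaurent f) = toLaurent (PowerSeries.expand n (NeZero.ne n) f) := by
  have hn : (0 : ℤ) < n := Int.natCast_pos.2 (NeZero.pos n)
  ext k
  by_cases hnk : (n : ℤ) ∣ k
  · obtain ⟨m, rfl⟩ := hnk
    rw [coeff_laurentExpand_mul]
    rcases lt_or_ge m 0 with hm | hm
    · rw [coeff_toLaurent_of_neg f hm, coeff_toLaurent_of_neg _ (mul_neg_of_pos_of_neg hn hm)]
    · lift m to ℕ using hm
      rw [← Nat.cast_mul, coeff_toLaurent_natCast, coeff_toLaurent_natCast,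
        PowerSeries.coeff_expand_mul]
  · rw [coeff_laurentExpand_of_not_dvd n _ hnk]
    rcases lt_or_ge k 0 with hk | hk
    · rw [coeff_toLaurent_of_neg _ hk]
    · lift k to ℕ using hk
      rw [coeff_toLaurent_natCast, PowerSeries.coeff_expand_of_not_dvd _ _ _
        (by exact_mod_cast hnk), Int.cast_zero]

end IntegralSeries

section Dissection

variable {R : Type*} [CommRing R]

/-- The series of the coefficients of `f` of index `i` modulo `n`. -/
noncomputable def dissect (n i : ℕ) (f : R⟦X⟧) : R⟦X⟧ :=
  PowerSeries.mk fun k => PowerSeries.coeff (n * k + i) f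

theorem coeff_dissect (n i : ℕ) (f : R⟦X⟧) (k : ℕ) :
    PowerSeries.coeff k (dissect n i f) = PowerSeries.coeff (n * k + i) f :=
  PowerSeries.coeff_mk _ _

theorem eq_sum_dissect (n : ℕ) [NeZero n] (f : R⟦X⟧) :
    f = ∑ i : Fin n, PowerSeries.X ^ (i : ℕ) *
      PowerSeries.expand n (NeZero.ne n) (dissect n i f) := by
  ext k
  rw [map_sum, Finset.sum_eq_single (Fin.ofNat n k)]
  · rw [PowerSeries.coeff_X_pow_mul', Fin.val_ofNat, if_pos (Nat.mod_le k n),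
      Nat.sub_eq_of_eq_add' (Nat.mod_add_div k n).symm, PowerSeries.coeff_expand_mul, coeff_dissect,
      Nat.div_add_mod]
  · intro i _ hi
    rw [PowerSeries.coeff_X_pow_mul']
    split_ifs with hik
    · refine PowerSeries.coeff_expand_of_not_dvd _ _ _ fun hdvd => hi (Fin.ext ?_)
      rw [Fin.val_ofNat, ← (Nat.modEq_iff_dvd' hik).2 hdvd, Nat.mod_eq_of_lt i.isLt]
    · rfl
  · simp

theorem toLaurent_eq_sum_dissect (n : ℕ) [NeZero n] (f : ℤ⟦X⟧) :
    toLaurent f =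
      ∑ i : Fin n, laurentX ℚ ^ (i : ℕ) * laurentExpand n (toLaurent (dissect n i f)) := by
  conv_lhs => rw [eq_sum_dissect n f]
  simp only [map_sum, map_mul, map_pow, toLaurent_X, laurentExpand_toLaurent]

end Dissection

section GeneratingFunctions

open scoped LaurentSeries

theorem toLaurent_betaSummand (n : ℕ) :
    toLaurent (betaSummand n) = laurentX ℚ * ((laurentX ℚ ^ 3) ^ (n * n + n) *
      (∏ k ∈ Finset.range (n + 1), ((1 - laurentX ℚ * (laurentX ℚ ^ 3) ^ k) *
        (1 - laurentX ℚ ^ 3 / laurentX ℚ * (laurentX ℚ ^ 3) ^ k)))⁻¹) := by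
  have hq := laurentX_ne_zero (F := ℚ)
  have hA := inAnnulus_pow_three ordGE_laurentX hq
  have hden : toLaurent (betaDenominator n) =
      ∏ k ∈ Finset.range (n + 1), ((1 - laurentX ℚ * (laurentX ℚ ^ 3) ^ k) *
        (1 - laurentX ℚ ^ 3 / laurentX ℚ * (laurentX ℚ ^ 3) ^ k)) := by
    rw [show laurentX ℚ ^ 3 / laurentX ℚ = laurentX ℚ ^ 2 by field_simp]
    simp only [betaDenominator, qShiftedFactorial, Finset.prod_mul_distrib, map_mul, map_prod,
      map_sub, map_one, map_pow, toLaurent_X]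
  have hne := Finset.prod_ne_zero_iff.2 fun k (_ : k ∈ Finset.range (n + 1)) =>
    mul_ne_zero (hA.one_sub_mul_pow_ne_zero k) (hA.base_div.one_sub_mul_pow_ne_zero k)
  have h := congr_arg toLaurent (betaSummand_mul_betaDenominator n)
  rw [map_mul, hden, map_pow, toLaurent_X, ← eq_mul_inv_iff_mul_eq₀ hne] at h
  rw [h]
  ring

theorem toLaurent_mockThetaBeta :
    toLaurent mockThetaBeta = laurentX ℚ *
      (appellLerch 3 (laurentX ℚ ^ 3) (laurentX ℚ) 1 * (euler (laurentX ℚ ^ 3))⁻¹) := by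
  have hA := inAnnulus_pow_three ordGE_laurentX (laurentX_ne_zero (F := ℚ))
  refine (summable_betaSummand.hasSum.map toLaurent continuous_toLaurent).unique ?_
  exact (hA.hasSum_appellLerch_three.mul_left _).congr_fun toLaurent_betaSummand

theorem laurentExpand_euler (n : ℕ) [NeZero n] :
    laurentExpand n (euler (laurentX ℚ)) = euler (laurentX ℚ ^ n) := by
  rw [map_euler (continuous_laurentExpand n) ordGE_laurentX, laurentExpand_laurentX]

theorem toLaurent_dissect_mockThetaBeta_mul_euler :
    (fun i : Fin 3 => toLaurent (dissect 3 i mockThetaBeta) * euler (laurentX ℚ)) =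
      ![laurentX ℚ * appellLerch 1 (laurentX ℚ ^ 3) (laurentX ℚ) (laurentX ℚ ^ 2),
        appellLerch 1 (laurentX ℚ ^ 3) (laurentX ℚ) 1,
        appellLerch 1 (laurentX ℚ ^ 3) (laurentX ℚ) (laurentX ℚ)] := by
  have hA := inAnnulus_pow_three ordGE_laurentX (laurentX_ne_zero (F := ℚ))
  have hexpand (z : ℚ⸨X⸩) :
      laurentExpand 3 (appellLerch 1 (laurentX ℚ ^ 3) (laurentX ℚ) z) =
        appellLerch 1 ((laurentX ℚ ^ 3) ^ 3) (laurentX ℚ ^ 3) (laurentExpand 3 z) := by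
    rw [hA.map_appellLerch (continuous_laurentExpand 3) z one_pos, map_pow, laurentExpand_laurentX]
  have hβ : toLaurent mockThetaBeta * euler (laurentX ℚ ^ 3) =
      laurentX ℚ * appellLerch 3 (laurentX ℚ ^ 3) (laurentX ℚ) 1 := by
    rw [toLaurent_mockThetaBeta, mul_assoc,
      inv_mul_cancel_right₀ (euler_ne_zero hA.ordGE_base)]
  rw [toLaurent_eq_sum_dissect 3, ← laurentExpand_euler, Finset.sum_mul,
    appellLerch_eq_sum hA 1 three_pos] at hβ
  refine eq_of_sum_laurentX_pow_mul_eq ((Finset.sum_congr rfl fun i _ => ?_).trans (hβ.trans ?_))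
  · rw [map_mul, mul_assoc]
  · simp only [Finset.sum_range, Fin.sum_univ_three, map_mul, hexpand,
      map_pow, map_one, laurentExpand_laurentX, Matrix.cons_val, Fin.val_zero, Fin.val_one,
      Fin.val_two, ← pow_mul]
    ring_nf

theorem euler_pow_three_mul_toLaurent_dissect_two :
    euler (laurentX ℚ ^ 3) ^ 3 * (laurentX ℚ * toLaurent (dissect 3 2 mockThetaBeta)) =
      weightedKroneckerSum (laurentX ℚ ^ 3) (laurentX ℚ) - weightedAppellSum (laurentX ℚ ^ 3) := by
  have hq := ordGE_laurentX (F := ℚ)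
  have hq0 := laurentX_ne_zero (F := ℚ)
  have hA := (inAnnulus_pow_three hq hq0).euler_pow_three_mul_appellLerch
  have hB : toLaurent (dissect 3 2 mockThetaBeta) * euler (laurentX ℚ) =
      appellLerch 1 (laurentX ℚ ^ 3) (laurentX ℚ) (laurentX ℚ) :=
    congr_fun toLaurent_dissect_mockThetaBeta_mul_euler 2
  rw [theta_pow_three_self hq hq0, ← hB] at hA
  refine mul_left_cancel₀ (euler_ne_zero hq) ?_
  linear_combination hA

theorem euler_pow_three_mul_toLaurent_dissect_one_dissect_two :
    euler (laurentX ℚ) ^ 3 * toLaurent (dissect 3 1 (dissect 3 2 mockThetaBeta)) =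
      lambertSum 3 2 (laurentX ℚ) := by
  have hq := ordGE_laurentX (F := ℚ)
  have hq0 := laurentX_ne_zero (F := ℚ)
  have hφ := continuous_laurentExpand (F := ℚ) 3
  have h := euler_pow_three_mul_toLaurent_dissect_two
  rw [toLaurent_eq_sum_dissect 3 (dissect 3 2 mockThetaBeta),
    weightedKroneckerSum_eq_sum (inAnnulus_pow_three hq hq0), ← laurentExpand_euler] at h
  have hL (c : Fin 3) : laurentExpand 3 (lambertSum 3 c (laurentX ℚ)) =
      lambertSum 3 c (laurentX ℚ ^ 3) := by
    rw [map_lambertSum hφ hq hq0 (by norm_num) c.isLt, laurentExpand_laurentX]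
  have hW : laurentExpand 3 (weightedAppellSum (laurentX ℚ)) =
      weightedAppellSum (laurentX ℚ ^ 3) := by
    rw [map_weightedAppellSum hφ hq hq0, laurentExpand_laurentX]
  rw [← hW] at h
  simp only [← hL] at h
  refine congr_fun (eq_of_sum_laurentX_pow_mul_eq (a := fun i : Fin 3 => euler (laurentX ℚ) ^ 3 *
      ![laurentX ℚ * toLaurent (dissect 3 2 (dissect 3 2 mockThetaBeta)),
        toLaurent (dissect 3 0 (dissect 3 2 mockThetaBeta)),
        toLaurent (dissect 3 1 (dissect 3 2 mockThetaBeta))] i)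
    (b := ![lambertSum 3 0 (laurentX ℚ) - weightedAppellSum (laurentX ℚ),
      lambertSum 3 1 (laurentX ℚ), lambertSum 3 2 (laurentX ℚ)]) ?_) 2
  simp only [Fin.sum_univ_three, map_mul, map_sub, map_pow, laurentExpand_laurentX,
    Matrix.cons_val, Fin.val_zero, Fin.val_one, Fin.val_two] at h ⊢
  linear_combination h

theorem toLaurent_pentagonalSeries :
    toLaurent (PowerSeries.pentagonalSeries ℤ) = euler (laurentX ℚ) := by
  rw [← PowerSeries.WithPiTopology.tprod_one_sub_X_pow,
    (PowerSeries.WithPiTopology.multipliable_one_sub_X_pow ℤ).map_tprod _ continuous_toLaurent]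
  simp only [map_sub, map_one, map_pow, toLaurent_X, euler]

theorem toLaurent_expand_pentagonalSeries (n : ℕ) [NeZero n] :
    toLaurent (PowerSeries.expand n (NeZero.ne n) (PowerSeries.pentagonalSeries ℤ)) =
      euler (laurentX ℚ ^ n) := by
  rw [← laurentExpand_toLaurent, toLaurent_pentagonalSeries, laurentExpand_euler]

theorem dissect_one_mockThetaBeta_mul :
    dissect 3 1 mockThetaBeta * PowerSeries.pentagonalSeries ℤ ^ 2 =
      PowerSeries.expand 3 three_ne_zero (PowerSeries.pentagonalSeries ℤ) ^ 3 := by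
  apply toLaurent_injective
  have hB : toLaurent (dissect 3 1 mockThetaBeta) * euler (laurentX ℚ) = _ :=
    congr_fun toLaurent_dissect_mockThetaBeta_mul_euler 1
  rw [map_mul, map_pow, map_pow, toLaurent_pentagonalSeries, toLaurent_expand_pentagonalSeries, sq,
    ← mul_assoc, hB]
  exact appellLerch_pow_three_self ordGE_laurentX laurentX_ne_zero

theorem dissect_one_dissect_two_mockThetaBeta_mul :
    dissect 3 1 (dissect 3 2 mockThetaBeta) * PowerSeries.pentagonalSeries ℤ ^ 5 =
      3 * PowerSeries.expand 3 three_ne_zero (PowerSeries.pentagonalSeries ℤ) ^ 6 := by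
  have hq := ordGE_laurentX (F := ℚ)
  have hq0 := laurentX_ne_zero (F := ℚ)
  apply toLaurent_injective
  have hB := euler_pow_three_mul_toLaurent_dissect_one_dissect_two
  have hA := appellLerch_pow_three_self hq hq0
  rw [map_mul, map_mul, map_pow, map_pow, map_ofNat, toLaurent_pentagonalSeries,
    toLaurent_expand_pentagonalSeries, show 6 = 3 * 2 by rfl, pow_mul, ← hA]
  linear_combination euler (laurentX ℚ) ^ 2 * (hB.trans (lambertSum_three_two hq hq0))

end GeneratingFunctions

section Congruences

open PowerSeries

theorem map_pentagonalSeries {R S : Type*} [CommRing R] [CommRing S] (f : R →+* S) :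
    PowerSeries.map f (pentagonalSeries R) = pentagonalSeries S := by
  ext n
  rw [coeff_map]
  by_cases hn : n ∈ Set.range pentagonal
  · obtain ⟨k, rfl⟩ := hn
    simp [coeff_pentagonalSeries_pentagonal]
  · rw [coeff_pentagonalSeries_eq_zero R hn, coeff_pentagonalSeries_eq_zero S hn, map_zero]

theorem isUnit_pentagonalSeries (R : Type*) [CommRing R] : IsUnit (pentagonalSeries R) := by
  rw [isUnit_iff_constantCoeff, ← coeff_zero_eq_constantCoeff_apply]
  have h := coeff_pentagonalSeries_pentagonal R 0
  simp_all [pentagonal_def]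

theorem hasSum_pentagonalSeries_pow_three :
    HasSum (fun r : ℕ => C ((-1) ^ r * (2 * r + 1) : ℤ) * (X : ℤ⟦X⟧) ^ (r * (r + 1) / 2))
      (pentagonalSeries ℤ ^ 3) := by
  have hq := ordGE_laurentX (F := ℚ)
  have hsum : Summable fun r : ℕ =>
      C ((-1) ^ r * (2 * r + 1) : ℤ) * (X : ℤ⟦X⟧) ^ (r * (r + 1) / 2) := by
    refine (WithPiTopology.summable_iff_summable_coeff ℤ).2 fun d =>
      summable_of_ne_finset_zero (s := Finset.range (d + 1)) fun r hr => ?_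
    have hrd : d < r * (r + 1) / 2 := by
      rw [Finset.mem_range, not_lt] at hr
      rw [Nat.lt_div_iff_mul_lt' (Nat.even_mul_succ_self r).two_dvd]
      nlinarith
    rw [coeff_C_mul, coeff_X_pow, if_neg hrd.ne, mul_zero]
  refine hsum.hasSum_iff.2 (toLaurent_injective ?_)
  rw [hsum.map_tsum _ continuous_toLaurent, map_pow, toLaurent_pentagonalSeries,
    ← tsum_int_mul_tri hq laurentX_ne_zero, tsum_int_eq_tsum_nat (summable_mul_ordGE
      (by simpa using summable_zpow_mul_tri hq 1 one_pos) ordGE_intCast)]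
  refine tsum_congr fun r => ?_
  have htri : tri r = (r * (r + 1) / 2 : ℕ) := by simp [tri]
  rw [neg_one_zpow_neg_one_sub, tri_neg_one_sub, htri, zpow_natCast, zpow_natCast,
    map_mul, map_pow, toLaurent_X, eq_intCast C, map_intCast]
  push_cast
  ring

theorem pow_eq_expand (p : ℕ) [Fact p.Prime] (f : (ZMod p)⟦X⟧) :
    f ^ p = expand p (NeZero.ne p) f := by
  have h := MvPowerSeries.map_frobenius_expand p (NeZero.ne p) (f := f)
  rw [ZMod.frobenius_zmod, MvPowerSeries.map_id] at h
  exact h.symm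

theorem coeff_mul_expand_eq_zero {R : Type*} [CommRing R] {p : ℕ} (hp : p ≠ 0) {f : R⟦X⟧}
    (g : R⟦X⟧) {n : ℕ} (hf : ∀ i : ℕ, (i : ZMod p) = n → coeff i f = 0) :
    coeff n (f * expand p hp g) = 0 := by
  rw [coeff_mul]
  refine Finset.sum_eq_zero fun ⟨i, j⟩ hij => ?_
  rw [Finset.HasAntidiagonal.mem_antidiagonal] at hij
  by_cases hj : p ∣ j
  · rw [hf i (by simp [← hij, (ZMod.natCast_eq_zero_iff j p).2 hj]), zero_mul]
  · rw [coeff_expand_of_not_dvd _ _ _ hj, mul_zero]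

/-- Dividing by a `p`-th power does not mix the residue classes of the exponents modulo `p`. -/
theorem coeff_eq_zero_of_mul_pow_eq {p : ℕ} [Fact p.Prime] {f g u : (ZMod p)⟦X⟧} (hu : IsUnit u)
    (h : f * u ^ p = g) {n : ℕ} (hg : ∀ i : ℕ, (i : ZMod p) = n → coeff i g = 0) :
    coeff n f = 0 := by
  obtain ⟨v, hv⟩ := hu.exists_right_inv
  have hf : f = g * expand p (NeZero.ne p) v := by
    rw [← pow_eq_expand, ← h, mul_assoc, ← mul_pow, hv, one_pow, mul_one]
  rw [hf]
  exact coeff_mul_expand_eq_zero _ v hg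

theorem intCast_dvd_coeff_iff (m : ℕ) (f : ℤ⟦X⟧) (n : ℕ) :
    (m : ℤ) ∣ coeff n f ↔ coeff n (PowerSeries.map (Int.castRingHom (ZMod m)) f) = 0 := by
  rw [coeff_map, eq_intCast, ZMod.intCast_zmod_eq_zero_iff_dvd]

theorem coeff_pentagonalSeries_pow_three_eq_zero {n : ℕ} (h0 : (n : ZMod 5) ≠ 0)
    (h1 : (n : ZMod 5) ≠ 1) : coeff n (pentagonalSeries (ZMod 5) ^ 3) = 0 := by
  rw [← map_pentagonalSeries (Int.castRingHom (ZMod 5)), ← map_pow, ← intCast_dvd_coeff_iff]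
  refine (isClosed_discrete {x : ℤ | ((5 : ℕ) : ℤ) ∣ x}).mem_of_tendsto
    ((WithPiTopology.hasSum_iff_hasSum_coeff ℤ).1 hasSum_pentagonalSeries_pow_three n)
    (Eventually.of_forall fun s => Finset.dvd_sum fun r _ => ?_)
  rw [coeff_C_mul, coeff_X_pow]
  split_ifs with hn
  · have hr : (2 * n : ZMod 5) = r * (r + 1) := by
      rw [hn]
      exact_mod_cast congr_arg (Nat.cast (R := ZMod 5))
        (Nat.two_mul_div_two_of_even (Nat.even_mul_succ_self r))
    have hmod : ∀ a b : ZMod 5, 2 * a = b * (b + 1) → a ≠ 0 → a ≠ 1 → 2 * b + 1 = 0 := by decide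
    rw [mul_one, ← ZMod.intCast_zmod_eq_zero_iff_dvd]
    push_cast
    rw [hmod n r hr h0 h1, mul_zero]
  · simp

theorem coeff_expand_three_pentagonalSeries_eq_zero {n : ℕ}
    (hn : (n : ZMod 5) = 2 ∨ (n : ZMod 5) = 4) :
    coeff n (expand 3 three_ne_zero (pentagonalSeries (ZMod 5))) = 0 := by
  by_cases h3 : 3 ∣ n
  · obtain ⟨m, rfl⟩ := h3
    rw [coeff_expand_mul, coeff_pentagonalSeries_eq_zero]
    rintro ⟨k, rfl⟩
    have hk : (2 * pentagonal k : ZMod 5) = k * (3 * k - 1) := by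
      exact_mod_cast congr_arg (Int.cast (R := ZMod 5)) (two_mul_natCast_pentagonal k)
    have hmod : ∀ a b : ZMod 5, 2 * a = b * (3 * b - 1) → ¬ (3 * a = 2 ∨ 3 * a = 4) := by decide
    exact hmod _ _ hk (by exact_mod_cast hn)
  · exact coeff_expand_of_not_dvd _ _ _ h3

theorem coeff_expand_three_mul_eq_zero {n : ℕ} (hn : (n : ZMod 5) = 2) :
    coeff n (expand 3 three_ne_zero (pentagonalSeries (ZMod 5) ^ 3) *
      pentagonalSeries (ZMod 5) ^ 3) = 0 := by
  have hmod : ∀ a b : ZMod 5, 3 * a + b = 2 → (a ≠ 0 ∧ a ≠ 1) ∨ (b ≠ 0 ∧ b ≠ 1) := by decide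
  rw [coeff_mul]
  refine Finset.sum_eq_zero fun ⟨j, k⟩ hjk => ?_
  rw [Finset.HasAntidiagonal.mem_antidiagonal] at hjk
  by_cases hj : 3 ∣ j
  · obtain ⟨m, rfl⟩ := hj
    rw [coeff_expand_mul]
    rcases hmod m k (by rw [← hn, ← hjk]; push_cast; rfl) with ⟨h0, h1⟩ | ⟨h0, h1⟩
    · rw [coeff_pentagonalSeries_pow_three_eq_zero h0 h1, zero_mul]
    · rw [coeff_pentagonalSeries_pow_three_eq_zero h0 h1, mul_zero]
  · rw [coeff_expand_of_not_dvd _ _ _ hj, zero_mul]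

theorem five_dvd_coeff_dissect_one {n : ℕ} (hn : (n : ZMod 5) = 2) :
    5 ∣ coeff n (dissect 3 1 mockThetaBeta) := by
  have : Fact (Nat.Prime 5) := ⟨Nat.prime_five⟩
  have h := congr_arg (PowerSeries.map (Int.castRingHom (ZMod 5))) dissect_one_mockThetaBeta_mul
  rw [map_mul, map_pow, map_pow, map_expand, map_pentagonalSeries] at h
  have h' := congr_arg (· * pentagonalSeries (ZMod 5) ^ 3) h
  simp only [mul_assoc, ← pow_add, Nat.reduceAdd] at h'
  refine (intCast_dvd_coeff_iff 5 _ n).2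
    (coeff_eq_zero_of_mul_pow_eq (isUnit_pentagonalSeries _) h' fun i hi => ?_)
  rw [← map_pow]
  exact coeff_expand_three_mul_eq_zero (hi.trans hn)

theorem five_dvd_coeff_dissect_one_dissect_two {n : ℕ}
    (hn : (n : ZMod 5) = 2 ∨ (n : ZMod 5) = 4) :
    5 ∣ coeff n (dissect 3 1 (dissect 3 2 mockThetaBeta)) := by
  have : Fact (Nat.Prime 5) := ⟨Nat.prime_five⟩
  have h := congr_arg (PowerSeries.map (Int.castRingHom (ZMod 5)))
    dissect_one_dissect_two_mockThetaBeta_mul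
  rw [map_mul, map_mul, map_pow, map_pow, map_expand, map_pentagonalSeries, map_ofNat] at h
  have hsplit : 3 * expand 3 three_ne_zero (pentagonalSeries (ZMod 5)) ^ 6 =
      expand 3 three_ne_zero (pentagonalSeries (ZMod 5)) *
        expand 5 (NeZero.ne 5) (3 * expand 3 three_ne_zero (pentagonalSeries (ZMod 5))) := by
    rw [map_mul, map_ofNat, ← pow_eq_expand]
    ring
  refine (intCast_dvd_coeff_iff 5 _ n).2
    (coeff_eq_zero_of_mul_pow_eq (isUnit_pentagonalSeries _) (h.trans hsplit) fun i hi => ?_)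
  refine coeff_mul_expand_eq_zero _ _ fun j hj => coeff_expand_three_pentagonalSeries_eq_zero ?_
  rwa [hj, hi]

theorem three_dvd_coeff_dissect_one_dissect_two (n : ℕ) :
    3 ∣ coeff n (dissect 3 1 (dissect 3 2 mockThetaBeta)) := by
  obtain ⟨f, hf⟩ := (((isUnit_pentagonalSeries ℤ).pow 5).dvd_mul_right).1
    (Dvd.intro _ dissect_one_dissect_two_mockThetaBeta_mul.symm)
  rw [hf, ← map_ofNat C, coeff_C_mul]
  exact dvd_mul_right _ _

theorem fifteen_dvd_pBeta {n : ℕ} (hn : (n : ZMod 5) = 2 ∨ (n : ZMod 5) = 4) :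
    15 ∣ pBeta (9 * n + 5) := by
  have h3 := three_dvd_coeff_dissect_one_dissect_two n
  have h5 := five_dvd_coeff_dissect_one_dissect_two hn
  rw [coeff_dissect, coeff_dissect, show 3 * (3 * n + 1) + 2 = 9 * n + 5 by ring] at h3 h5
  exact IsCoprime.mul_dvd (by norm_num) h3 h5

theorem five_dvd_pBeta {n : ℕ} (hn : (n : ZMod 5) = 2) : 5 ∣ pBeta (3 * n + 1) := by
  have h := five_dvd_coeff_dissect_one hn
  rwa [coeff_dissect] at h

end Congruences

end MockTheta

theorem mainTheorem8 (n : ℕ) :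
    pBeta (15 * n + 7) ≡ 0 [ZMOD 5] ∧
    pBeta (45 * n + 23) ≡ 0 [ZMOD 15] ∧
    pBeta (45 * n + 41) ≡ 0 [ZMOD 15] := by
  have h5 : (5 * n : ZMod 5) = 0 := by reduce_mod_char
  refine ⟨Int.modEq_zero_iff_dvd.2 ?_, Int.modEq_zero_iff_dvd.2 ?_, Int.modEq_zero_iff_dvd.2 ?_⟩
  · rw [show 15 * n + 7 = 3 * (5 * n + 2) + 1 by ring]
    exact MockTheta.five_dvd_pBeta (by simp [h5])
  · rw [show 45 * n + 23 = 9 * (5 * n + 2) + 5 by ring]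
    exact MockTheta.fifteen_dvd_pBeta (.inl (by simp [h5]))
  · rw [show 45 * n + 41 = 9 * (5 * n + 4) + 5 by ring]
    exact MockTheta.fifteen_dvd_pBeta (.inr (by simp [h5]))
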